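/- Let $\mathcal D$ be the family of dyadic intervals $[k2^{-j},(k+1)2^{-j})$, $j,k\in\mathbb Z$; for $L\in\mathcal D$ let $\mathcal D_m(L)$ be the set of dyadic subintervals of $L$ of length $2^{-m}|L|$. Write $m_Iu=\frac1{|I|}\int_I u\,dx$ and let $h_I=|I|^{-1/2}(\chi_{I_+}-\chi_{I_-})$ be the Haar function of $I$, where $I_+$, $I_-$ are the right and left halves of $I$. A weight is a locally integrable function $w:\mathbb R\to\mathbb R$ that is positive almost everywhere. For $1<p<\infty$ and $s\in\mathbb R$ put $$[w]_{A_p^d}=\sup_{I\in\mathcal D}(m_Iw)\big(m_Iw^{-1/(p-1)}\big)^{p-1},\qquad [w]_{C_s^d}=\sup_{I\in\mathcal D}(m_Iw^s)(m_Iw)^{-s},$$ and let $A_p^d$, $C_s^d$ be the classes of weights for which these are finite, $A_\infty^d=\bigcup_{p>1}A_p^d$. For $t\in\mathbb R$ and integers $m,n\ge 0$ the $t$-Haar multiplier of complexity $(m,n)$ is $$T_{t,w}^{m,n}f(x)=\sum_{L\in\mathcal D}\ \sum_{I\in\mathcal D_m(L),\,J\in\mathcal D_n(L)}\frac{\sqrt{|I||J|}}{|L|}\,\frac{w^t(x)}{(m_Lw)^t}\,\langle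 f,h_I\rangle\,h_J(x).$$ **Theorem.** Let $t\in\mathbb R$ and $w\in C_{2t}^d$. If $w\in A^d_\infty$, then $w^{2t}\in A_q^d$ for some $q>1$. Moreover, in each of the following cases, for all $m,n\ge 0$ and all $f\in L^2(\mathbb R)$ the series defining $T_{t,w}^{m,n}f$ (summed over $L$) converges unconditionally in $L^2(\mathbb R)$, and the stated bounds hold. Here $C_q$ depends only on $q$, $C_p'$ depends only on $p$, and $C$ is an absolute constant. - (i) If $0\le 2t<1$ and $w\in A_q^d$ with $q>1$, then $w^{2t}\in A_q^d$ and $$\|T_{t,w}^{m,n}f\|_2\le C_q(m+n+2)^3[w^{2t}]_{A_q^d}^{1/2}\|f\|_2\le C_q(m+n+2)^3[w]_{A_q^d}^{t}\|f\|_2.$$ - (ii) If $2t\ge1$ and $w\in A_p^d$ with $p>1$, then for $q=2t(p-1)+1$ we have $w^{2t}\in A_q^d$ and $$\|T_{t,w}^{m,n}f\|_2\le C_q(m+n+2)^3[w]_{C_{2t}^d}^{1/2}[w^{2t}]_{A_q^d}^{1/2}\|f\|_2\le C_p'(m+n+2)^3[w]_{C_{2t}^d}[w]_{A_p^d}^{t}\|f\|_2,$$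 and also $$\|T_{t,w}^{m,n}f\|_2\le C_p'(m+n+2)^3[w]_{C_{2t}^d}[w]_{A_p^d}\|f\|_2.$$ - (iii) If $t<0$, then $w^{2t}\in A_q^d$ for $q=1-2t$, $w\in A^d_{1-1/(2t)}$, and $$\|T_{t,w}^{m,n}f\|_2\le C(m+n+2)^3[w]_{C_{2t}^d}\|f\|_2=C(m+n+2)^3[w]_{A^d_{1-1/(2t)}}^{-2t}\|f\|_2.$$ -/

import Mathlib

open MeasureTheory Filter Topology
open scoped NNReal ENNReal

noncomputable section

/-- The dyadic interval `[k 2⁻ʲ, (k+1) 2⁻ʲ)`, recorded by its scale `j` and its position `k`. -/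
@[ext] structure DyadicInterval where
  scale : ℤ
  pos : ℤ

namespace DyadicInterval

/-- The length `|I|` of a dyadic interval. -/
def len (I : DyadicInterval) : ℝ := (2 : ℝ) ^ (-I.scale)

/-- The dyadic interval as a subset of the line. -/
def toSet (I : DyadicInterval) : Set ℝ := Set.Ico (I.pos * I.len) ((I.pos + 1) * I.len)

/-- The left half `I₋`. -/
def leftHalf (I : DyadicInterval) : DyadicInterval := ⟨I.scale + 1, 2 * I.pos⟩

/-- The right half `I₊`. -/
def rightHalf (I : DyadicInterval) : DyadicInterval := ⟨I.scale + 1, 2 * I.pos + 1⟩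

/-- `𝒟ₘ(L)`: the dyadic subintervals of `L` of length `2⁻ᵐ |L|`
(see `mem_descendants` for this description). -/
def descendants (L : DyadicInterval) (m : ℕ) : Finset DyadicInterval :=
  (Finset.range (2 ^ m)).map
    ⟨fun i : ℕ => ⟨L.scale + m, 2 ^ m * L.pos + i⟩, fun a b h => by simpa using h⟩

theorem len_pos (I : DyadicInterval) : 0 < I.len := by unfold len; positivity

theorem mem_descendants {I L : DyadicInterval} {m : ℕ} :
    I ∈ L.descendants m ↔ I.toSet ⊆ L.toSet ∧ I.len = 2 ^ (-(m : ℤ)) * L.len := by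
  obtain ⟨j, k⟩ := I
  obtain ⟨j', k'⟩ := L
  have key : (2 : ℝ) ^ (-j) = 2 ^ (-(m : ℤ)) * 2 ^ (-j') ↔ j = j' + m := by
    rw [← zpow_add₀ (by norm_num : (2 : ℝ) ≠ 0)]
    constructor
    · intro h
      have := zpow_right_injective₀ (by norm_num : (0 : ℝ) < 2) (by norm_num) h
      omega
    · rintro rfl
      congr 1
      omega
  have mem : (⟨j, k⟩ : DyadicInterval) ∈ descendants ⟨j', k'⟩ m ↔
      j = j' + m ∧ 2 ^ m * k' ≤ k ∧ k + 1 ≤ 2 ^ m * (k' + 1) := by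
    rw [descendants, Finset.mem_map]
    constructor
    · rintro ⟨i, hi, h⟩
      have h1 : j' + (m : ℤ) = j := congrArg scale h
      have h2 : 2 ^ m * k' + (i : ℤ) = k := congrArg pos h
      have hi' : (i : ℤ) < 2 ^ m := by exact_mod_cast Finset.mem_range.mp hi
      refine ⟨h1.symm, by omega, ?_⟩
      rw [mul_add, mul_one]
      omega
    · rintro ⟨h1, h2, h3⟩
      rw [mul_add, mul_one] at h3
      have e : ((k - 2 ^ m * k').toNat : ℤ) = k - 2 ^ m * k' := Int.toNat_of_nonneg (by omega)
      refine ⟨(k - 2 ^ m * k').toNat, Finset.mem_range.mpr ?_, ?_⟩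
      · have h4 : ((k - 2 ^ m * k').toNat : ℤ) < ((2 ^ m : ℕ) : ℤ) := by
          rw [e]
          push_cast
          omega
        exact_mod_cast h4
      · apply DyadicInterval.ext
        · exact h1.symm
        · show 2 ^ m * k' + ((k - 2 ^ m * k').toNat : ℤ) = k
          rw [e]
          ring
  rw [mem]
  simp only [len, toSet, key]
  rw [and_comm]
  refine and_congr_left ?_
  rintro rfl
  have hp : (0 : ℝ) < 2 ^ (-(j' + (m : ℤ))) := by positivity
  have e : (2 : ℝ) ^ (-j') = 2 ^ m * 2 ^ (-(j' + (m : ℤ))) := by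
    rw [← zpow_natCast, ← zpow_add₀ (by norm_num : (2 : ℝ) ≠ 0)]
    congr 1
    omega
  rw [Set.Ico_subset_Ico_iff (by nlinarith), e, ← mul_assoc, ← mul_assoc,
    mul_le_mul_iff_left₀ hp, mul_le_mul_iff_left₀ hp]
  rw [mul_comm (k' : ℝ), mul_comm ((k' : ℝ) + 1)]
  norm_cast

end DyadicInterval

/-- A weight on the line: a locally integrable function that is positive almost everywhere. -/
structure IsWeight (w : ℝ → ℝ) : Prop where
  locallyIntegrable : LocallyIntegrable w volume
  ae_pos : ∀ᵐ x ∂(volume : Measure ℝ), 0 < w x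

/-- The average `m_I u ∈ [0, ∞]` of a nonnegative function over a dyadic interval. -/
def lavg (u : ℝ → ℝ) (I : DyadicInterval) : ℝ≥0∞ :=
  ⨍⁻ x in I.toSet, ENNReal.ofReal (u x) ∂volume

/-- The dyadic Muckenhoupt characteristic
`[w]_{A_p^d} = sup_I (m_I w) (m_I w^{-1/(p-1)})^{p-1}`, for `1 < p < ∞`. -/
def apChar (p : ℝ) (w : ℝ → ℝ) : ℝ≥0∞ :=
  ⨆ I : DyadicInterval, lavg w I * lavg (fun x => w x ^ (-1 / (p - 1))) I ^ (p - 1)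

/-- The characteristic `[w]_{C_s^d} = sup_I (m_I w^s) (m_I w)^{-s}`, for real `s`. -/
def cChar (s : ℝ) (w : ℝ → ℝ) : ℝ≥0∞ :=
  ⨆ I : DyadicInterval, lavg (fun x => w x ^ s) I * lavg w I ^ (-s)

/-- `w ∈ A_p^d`. -/
structure MemAp (p : ℝ) (w : ℝ → ℝ) : Prop where
  one_lt : 1 < p
  isWeight : IsWeight w
  char_lt_top : apChar p w < ∞

/-- `w ∈ A_∞^d`, the union of the classes `A_p^d` over `p > 1`. -/
def MemAInfty (w : ℝ → ℝ) : Prop := ∃ p : ℝ, MemAp p w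

/-- `w ∈ C_s^d`. -/
structure MemC (s : ℝ) (w : ℝ → ℝ) : Prop where
  isWeight : IsWeight w
  char_lt_top : cChar s w < ∞

/-- The `L²`-normalized Haar function `h_I = |I|^{-1/2} (χ_{I₊} - χ_{I₋})`. -/
def haar (I : DyadicInterval) (x : ℝ) : ℝ :=
  (Real.sqrt I.len)⁻¹ *
    (I.rightHalf.toSet.indicator (fun _ => (1 : ℝ)) x
      - I.leftHalf.toSet.indicator (fun _ => (1 : ℝ)) x)

/-- The Haar coefficient `⟨f, h_I⟩`. -/
def haarCoeff (f : ℝ → ℂ) (I : DyadicInterval) : ℂ := ∫ x, f x * (haar I x : ℂ)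

/-- The summand indexed by `L` in the `t`-Haar multiplier of complexity `(m, n)`:
`∑_{I ∈ 𝒟ₘ(L), J ∈ 𝒟ₙ(L)} (√(|I| |J|) / |L|) (w(x)^t / (m_L w)^t) ⟨f, h_I⟩ h_J(x)`. -/
def haarMultiplierTerm (t : ℝ) (w : ℝ → ℝ) (m n : ℕ) (f : ℝ → ℂ) (L : DyadicInterval)
    (x : ℝ) : ℂ :=
  ∑ I ∈ L.descendants m, ∑ J ∈ L.descendants n,
    ((Real.sqrt (I.len * J.len) / L.len : ℝ) : ℂ)
      * ((w x ^ t / (⨍ y in L.toSet, w y ∂volume) ^ t : ℝ) : ℂ)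
      * haarCoeff f I * (haar J x : ℂ)

/-- `T_{t,w}^{m,n} f = g` in `L²(ℝ)`: the function `g` is square integrable, and the series over
all dyadic intervals `L` that defines `T_{t,w}^{m,n} f` converges unconditionally to `g` in
`L²(ℝ)`. -/
structure IsHaarMultiplier (t : ℝ) (w : ℝ → ℝ) (m n : ℕ) (f g : ℝ → ℂ) : Prop where
  memLp : MemLp g 2 volume
  tendsto : Tendsto
    (fun S : Finset DyadicInterval =>
      eLpNorm (fun x => (∑ L ∈ S, haarMultiplierTerm t w m n f L x) - g x) 2 volume)
    atTop (𝓝 0)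

end

/-! ### One-step inequalities: a Buckley potential and the telescoping increment. -/

noncomputable section

/-! Each summand of the series is a product a_L φ_L. The scalar a_L is |L|^{-1/2} times the sum over
I ∈ 𝒟ₘ(L) of the difference of ∫ f over the two halves of I; the function φ_L is |L|^{-1/2} (m_L
w)^{-t} w^t times the sum over J ∈ 𝒟ₙ(L) of χ_{J₊} - χ_{J₋}. By duality (`exists_hasSum_smul`),
unconditional convergence and the norm bound follow from ∑ |a_L|² ≤ 386 ‖f‖² and ∑ |⟨φ_L, h⟩|² ≤ 386
c A ‖h‖². Both come from one weighted square function estimate, `tsum_haarBlock_integral_le`, the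
first with all weights equal to one.

Complexity costs nothing. If X denotes the averages of v = w^{2t}, then |L| X_L is the sum of |J|
X_J over J ∈ 𝒟ₙ(L), so Cauchy-Schwarz bounds a block of increments by its single increments
(`tsum_haarBlock_le`), and each J lies in only one block. The factor (m+n+2)³ is used only through
being at least one.

For single increments, let y be the averages of w^t h. The increment of y splits into a part adapted
to v, controlled by the convexity of y²/X, and a multiple of the relative increment of X, controlled
as in Carleson's embedding theorem by the convexity of y²/ω, where ω is a supermartingale comparable
to X whose drop dominates (X₁ - X₂)²/X. Summing over the dyadic tree telescopes. Such an ω can be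
written down as soon as γ² ≤ X ≤ A γ² for a positive dyadic submartingale γ
(`buckleyPotential_step`).

The constant c = [w]_{C_{2t}} compares X with (m_L w)^{2t}. If v ∈ A_q, take γ = (m_I
v^{-1/(q-1)})^{-(q-1)/2} and A = [v]_{A_q}; if t ≥ 1, one may instead take γ = (m_I w)^t and A =
[w]_{C_{2t}}. The resulting bound 386 √(cA) becomes the stated ones through Jensen's inequality and
elementary relations between characteristics. -/

/-- The potential whose defect of additivity controls the relative increments of `X = a ^ 2`. -/
def buckleyPotential (s a g : ℝ) : ℝ := 2 * s * (a * g) - 2 * s ^ 2 * g ^ 2 + 2 * s ^ 2 * a ^ 2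

theorem buckleyPotential_nonneg {s a g : ℝ} (hs : 0 ≤ s) (hg : 0 ≤ g) (hga : g ≤ a) :
    0 ≤ buckleyPotential s a g := by
  have h1 : g ^ 2 ≤ a ^ 2 := by gcongr
  have h2 : 0 ≤ s * (a * g) := by have := hg.trans hga; positivity
  unfold buckleyPotential
  nlinarith [mul_le_mul_of_nonneg_left h1 (sq_nonneg s)]

theorem buckleyPotential_le {s a g : ℝ} (hs : 1 ≤ s) (hg : 0 ≤ g) (hga : g ≤ a) :
    buckleyPotential s a g ≤ 4 * s ^ 2 * a ^ 2 := by
  have h1 : a * g ≤ a ^ 2 := by nlinarith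
  have h2 : s ≤ s ^ 2 := by nlinarith
  have h3 : s * (a * g) ≤ s ^ 2 * a ^ 2 := by
    have : 0 ≤ a * g := by have := hg.trans hga; positivity
    gcongr
  unfold buckleyPotential
  nlinarith [mul_nonneg (sq_nonneg s) (sq_nonneg g)]

theorem sq_sub_sq_sq_le {a b : ℝ} (ha : 0 ≤ a) (hb : 0 ≤ b) (h : b ^ 2 ≤ 2 * a ^ 2) :
    (b ^ 2 - a ^ 2) ^ 2 ≤ 6 * a ^ 2 * (b - a) ^ 2 := by
  -- Expand: b² ≤ 2a² and 2ab ≤ 3a². Squaring b + a ≤ 5a/2 would give only 25/4.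
  have h1 : (b + a) ^ 2 ≤ 6 * a ^ 2 := by
    have : b ≤ 3 / 2 * a := by nlinarith
    nlinarith
  calc (b ^ 2 - a ^ 2) ^ 2 = (b + a) ^ 2 * (b - a) ^ 2 := by ring
    _ ≤ _ := by gcongr

/-- Split b - a = (bg - ha)/g + a(h - g)/g and use (u + v)² ≤ 2u² + 2v²; the slack (u - v)²/4 is
explicit. -/
theorem sq_sub_le_normalized (a b h : ℝ) {g : ℝ} (hg : 0 < g) :
    (b - a) ^ 2 / 4 ≤ 1 / g ^ 2 * ((b * g - h * a) ^ 2 / 2) + a ^ 2 / g ^ 2 * ((h - g) ^ 2 / 2) := by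
  have : 1 / g ^ 2 * ((b * g - h * a) ^ 2 / 2) + a ^ 2 / g ^ 2 * ((h - g) ^ 2 / 2)
      - (b - a) ^ 2 / 4 = (b * g - h * a - a * (h - g)) ^ 2 / (4 * g ^ 2) := by
    field_simp
    ring
  have h2 : 0 ≤ (b * g - h * a - a * (h - g)) ^ 2 / (4 * g ^ 2) := by positivity
  linarith

/-- The a² term is additive and drops out. The product ag is the geometric mean of a² and g²; its
deviation from the tangent plane at (a², g²) gives the squares of aᵢg - gᵢa, and the drift of g²
gives the remaining terms. -/
theorem buckleyPotential_gap {s a a₁ a₂ g g₁ g₂ : ℝ} (ha : a ≠ 0) (hg : g ≠ 0)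
    (hA : a ^ 2 = (a₁ ^ 2 + a₂ ^ 2) / 2) :
    buckleyPotential s a g - (buckleyPotential s a₁ g₁ + buckleyPotential s a₂ g₂) / 2
      = - (s * a / g * ((g₁ ^ 2 + g₂ ^ 2) / 2 - g ^ 2))
        + s / (a * g) * (((a₁ * g - g₁ * a) ^ 2 + (a₂ * g - g₂ * a) ^ 2) / 2)
        + 2 * s ^ 2 * ((g₁ ^ 2 + g₂ ^ 2) / 2 - g ^ 2) := by
  have h : a₁ ^ 2 = 2 * a ^ 2 - a₂ ^ 2 := by linarith
  have e : ((a₁ * g - g₁ * a) ^ 2 + (a₂ * g - g₂ * a) ^ 2) / 2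
      = a * g * (a * g + a * ((g₁ ^ 2 + g₂ ^ 2) / 2) / g - (a₁ * g₁ + a₂ * g₂)) := by
    field_simp
    linear_combination (g ^ 2) * h
  rw [e]
  have e' : ∀ z : ℝ, s / (a * g) * (a * g * z) = s * z := fun z => by field_simp
  rw [e']
  have e'' : s * a / g * ((g₁ ^ 2 + g₂ ^ 2) / 2 - g ^ 2)
      = s * (a * ((g₁ ^ 2 + g₂ ^ 2) / 2) / g - a * g) := by
    field_simp
  rw [e'']
  unfold buckleyPotential
  linear_combination (- s ^ 2) * h

/-- The only negative term of the gap is at most half of 2s²Q, because a ≤ sg. What remains controls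
both the fluctuation of g and that of a relative to g, hence that of a and of a². -/
theorem buckleyPotential_step {s a a₁ a₂ g g₁ g₂ : ℝ} (hs : 0 ≤ s) (ha : 0 < a) (ha₁ : 0 ≤ a₁)
    (ha₂ : 0 ≤ a₂) (hg : 0 < g) (hA : a ^ 2 = (a₁ ^ 2 + a₂ ^ 2) / 2)
    (hG : 2 * g ≤ g₁ + g₂) (has : a ≤ s * g) :
    (a₁ ^ 2 - a₂ ^ 2) ^ 2 / (48 * a ^ 2) ≤ buckleyPotential s a g
      - (buckleyPotential s a₁ g₁ + buckleyPotential s a₂ g₂) / 2 := by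
  obtain ⟨Q, hQ⟩ : ∃ Q, Q = (g₁ ^ 2 + g₂ ^ 2) / 2 - g ^ 2 := ⟨_, rfl⟩
  obtain ⟨δ, hd⟩ : ∃ δ, δ = (a₁ * g - g₁ * a) ^ 2 + (a₂ * g - g₂ * a) ^ 2 := ⟨_, rfl⟩
  -- The difference of the two sides is g(g₁ + g₂ - 2g), nonnegative by the submartingale property.
  have hQ1 : ((g₁ - g) ^ 2 + (g₂ - g) ^ 2) / 2 ≤ Q := by nlinarith
  have hQ0 : 0 ≤ Q := le_trans (by positivity) hQ1
  have e1 : buckleyPotential s a g - (buckleyPotential s a₁ g₁ + buckleyPotential s a₂ g₂) / 2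
      = - (s * a / g * Q) + s / (a * g) * (δ / 2) + 2 * s ^ 2 * Q := by
    rw [hQ, hd]
    exact buckleyPotential_gap ha.ne' hg.ne' hA
  have hd0 : 0 ≤ δ / 2 := by rw [hd]; positivity
  have e2 : s * a / g * Q ≤ s ^ 2 * Q := by
    apply mul_le_mul_of_nonneg_right _ hQ0
    rw [div_le_iff₀ hg]
    nlinarith
  have e3 : 1 / g ^ 2 * (δ / 2) ≤ s / (a * g) * (δ / 2) := by
    apply mul_le_mul_of_nonneg_right _ hd0
    rw [div_le_div_iff₀ (by positivity) (by positivity)]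
    nlinarith
  have e4 : a ^ 2 / g ^ 2 * (((g₁ - g) ^ 2 + (g₂ - g) ^ 2) / 2) ≤ s ^ 2 * Q := by
    have : a ^ 2 / g ^ 2 ≤ s ^ 2 := by
      rw [div_le_iff₀ (by positivity), ← mul_pow]
      gcongr
    exact mul_le_mul this hQ1 (by positivity) (by positivity)
  have e5 : ((a₁ - a) ^ 2 + (a₂ - a) ^ 2) / 4 ≤ 1 / g ^ 2 * (δ / 2)
      + a ^ 2 / g ^ 2 * (((g₁ - g) ^ 2 + (g₂ - g) ^ 2) / 2) := by
    have h := add_le_add (sq_sub_le_normalized a a₁ g₁ hg) (sq_sub_le_normalized a a₂ g₂ hg)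
    refine le_trans (le_of_eq (by ring)) (h.trans (le_of_eq ?_))
    rw [hd]
    ring
  have e6 : (a₁ ^ 2 - a₂ ^ 2) ^ 2 / (48 * a ^ 2) ≤ ((a₁ - a) ^ 2 + (a₂ - a) ^ 2) / 4 := by
    rw [div_le_iff₀ (by positivity)]
    have h1 := sq_sub_sq_sq_le ha.le ha₁ (by nlinarith)
    have h2 := sq_sub_sq_sq_le ha.le ha₂ (by nlinarith)
    have h3 : a₁ ^ 2 - a ^ 2 = (a₁ ^ 2 - a₂ ^ 2) / 2 := by linarith
    have h4 : a₂ ^ 2 - a ^ 2 = -((a₁ ^ 2 - a₂ ^ 2) / 2) := by linarith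
    rw [h3] at h1
    rw [h4] at h2
    linear_combination 2 * h1 + 2 * h2
  rw [e1]
  linarith

/-- One step of the telescoping argument, for real increments. -/
theorem square_step_real {B X X₁ X₂ ω ω₁ ω₂ y y₁ y₂ : ℝ} (hX : 0 < X) (hX₁ : 0 < X₁)
    (hX₂ : 0 < X₂) (hω₁ : 0 < ω₁) (hω₂ : 0 < ω₂) (hXe : X = (X₁ + X₂) / 2) (hω : 0 < ω)
    (hωB : ω ≤ 8 * B * X)
    (hstep : (X₁ - X₂) ^ 2 / (48 * X) ≤ ω - (ω₁ + ω₂) / 2) (hy : y = (y₁ + y₂) / 2) :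
    ((y₁ - y₂) / 2) ^ 2 / X ≤
      ((2 * (y₁ ^ 2 / X₁) + 1536 * B ^ 2 * (y₁ ^ 2 / ω₁))
        + (2 * (y₂ ^ 2 / X₂) + 1536 * B ^ 2 * (y₂ ^ 2 / ω₂))) / 2
      - (2 * (y ^ 2 / X) + 1536 * B ^ 2 * (y ^ 2 / ω)) := by
  set d := (y₁ - y₂) / 2 with hd
  set x := (X₁ - X₂) / (2 * X) with hx
  -- Here d - xy is the increment adapted to the weight: it vanishes when y is proportional to X.
  have k1 : (d - x * y) ^ 2 / X ≤ (y₁ ^ 2 / X₁ + y₂ ^ 2 / X₂) / 2 - y ^ 2 / X := by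
    have hprod : X₁ * X₂ ≤ X ^ 2 := by rw [hXe]; nlinarith [sq_nonneg (X₁ - X₂)]
    have : (y₁ ^ 2 / X₁ + y₂ ^ 2 / X₂) / 2 - y ^ 2 / X
        = (d - x * y) ^ 2 * X / (X₁ * X₂) := by
      rw [hd, hx, hy, hXe]
      field_simp
      ring
    rw [this, div_le_div_iff₀ hX (by positivity)]
    calc (d - x * y) ^ 2 * (X₁ * X₂) ≤ (d - x * y) ^ 2 * X ^ 2 := by gcongr
      _ = _ := by ring
  -- Carleson embedding: y²/ω is jointly convex, which gives the inequality with the mean η, and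
  -- decreasing in ω, so the drop from ω to η adds at least (ω - η) y²/ω².
  have k2 : x ^ 2 * y ^ 2 / X ≤
      768 * B ^ 2 * ((y₁ ^ 2 / ω₁ + y₂ ^ 2 / ω₂) / 2 - y ^ 2 / ω) := by
    set η := (ω₁ + ω₂) / 2 with hη
    have hη0 : 0 < η := by positivity
    have t1 : y ^ 2 / η ≤ (y₁ ^ 2 / ω₁ + y₂ ^ 2 / ω₂) / 2 := by
      have : (y₁ ^ 2 / ω₁ + y₂ ^ 2 / ω₂) / 2 - y ^ 2 / η
          = (y₁ * ω₂ - y₂ * ω₁) ^ 2 / (2 * ω₁ * ω₂ * (ω₁ + ω₂)) := by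
        rw [hη, hy]
        field_simp
        ring
      have h2 : 0 ≤ (y₁ * ω₂ - y₂ * ω₁) ^ 2 / (2 * ω₁ * ω₂ * (ω₁ + ω₂)) := by positivity
      linarith
    have hgap : 0 ≤ ω - η := le_trans (by positivity) hstep
    have t2 : (ω - η) / ω ^ 2 * y ^ 2 ≤ y ^ 2 / η - y ^ 2 / ω := by
      have : y ^ 2 / η - y ^ 2 / ω = (ω - η) / (η * ω) * y ^ 2 := by field_simp
      rw [this]
      apply mul_le_mul_of_nonneg_right _ (sq_nonneg y)
      apply div_le_div_of_nonneg_left hgap (by positivity)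
      nlinarith
    -- 768 = 12 · 8²: 12 = 48/4 from the definition of x, and 8² from ω ≤ 8BX.
    have t3 : x ^ 2 / X ≤ 768 * B ^ 2 * ((ω - η) / ω ^ 2) := by
      have hsq : ω ^ 2 ≤ (8 * B * X) ^ 2 := by gcongr
      have : x ^ 2 / X = 12 * ((X₁ - X₂) ^ 2 / (48 * X)) / X ^ 2 := by
        rw [hx]; field_simp; ring
      rw [this, ← mul_div_assoc (768 * B ^ 2),
        div_le_div_iff₀ (sq_pos_of_pos hX) (sq_pos_of_pos hω)]
      calc 12 * ((X₁ - X₂) ^ 2 / (48 * X)) * ω ^ 2 ≤ 12 * (ω - η) * (8 * B * X) ^ 2 := by gcongr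
        _ = _ := by ring
    have hB : 0 ≤ 768 * B ^ 2 := by positivity
    calc x ^ 2 * y ^ 2 / X = x ^ 2 / X * y ^ 2 := by ring
      _ ≤ 768 * B ^ 2 * ((ω - η) / ω ^ 2) * y ^ 2 := by gcongr
      _ = 768 * B ^ 2 * ((ω - η) / ω ^ 2 * y ^ 2) := by ring
      _ ≤ _ := by
        apply mul_le_mul_of_nonneg_left _ hB
        linarith
  have k3 : d ^ 2 / X ≤ 2 * ((d - x * y) ^ 2 / X) + 2 * (x ^ 2 * y ^ 2 / X) := by
    have : 2 * ((d - x * y) ^ 2 / X) + 2 * (x ^ 2 * y ^ 2 / X) - d ^ 2 / X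
        = (d - 2 * (x * y)) ^ 2 / X := by ring
    have h2 : 0 ≤ (d - 2 * (x * y)) ^ 2 / X := by positivity
    linarith
  linarith

/-- One step of the telescoping argument, for complex increments. -/
theorem square_step {B X X₁ X₂ ω ω₁ ω₂ : ℝ} {y y₁ y₂ : ℂ} (hX : 0 < X) (hX₁ : 0 < X₁)
    (hX₂ : 0 < X₂) (hω₁ : 0 < ω₁) (hω₂ : 0 < ω₂) (hXe : X = (X₁ + X₂) / 2) (hω : 0 < ω)
    (hωB : ω ≤ 8 * B * X)
    (hstep : (X₁ - X₂) ^ 2 / (48 * X) ≤ ω - (ω₁ + ω₂) / 2) (hy : y = (y₁ + y₂) / 2) :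
    ‖(y₁ - y₂) / 2‖ ^ 2 / X ≤
      ((2 * (‖y₁‖ ^ 2 / X₁) + 1536 * B ^ 2 * (‖y₁‖ ^ 2 / ω₁))
        + (2 * (‖y₂‖ ^ 2 / X₂) + 1536 * B ^ 2 * (‖y₂‖ ^ 2 / ω₂))) / 2
      - (2 * (‖y‖ ^ 2 / X) + 1536 * B ^ 2 * (‖y‖ ^ 2 / ω)) := by
  have hre := square_step_real (y := y.re) (y₁ := y₁.re) (y₂ := y₂.re) hX hX₁ hX₂ hω₁ hω₂ hXe hω
    hωB hstep (by rw [hy]; simp)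
  have him := square_step_real (y := y.im) (y₁ := y₁.im) (y₂ := y₂.im) hX hX₁ hX₂ hω₁ hω₂ hXe hω
    hωB hstep (by rw [hy]; simp)
  have e : ∀ z : ℂ, ‖z‖ ^ 2 = z.re ^ 2 + z.im ^ 2 := fun z => by
    rw [← Complex.normSq_eq_norm_sq, Complex.normSq_apply]; ring
  rw [e, e, e, e]
  have h1 : ((y₁ - y₂) / 2).re = (y₁.re - y₂.re) / 2 := by simp
  have h2 : ((y₁ - y₂) / 2).im = (y₁.im - y₂.im) / 2 := by simp
  rw [h1, h2]
  simp only [add_div, mul_add]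
  simp only [add_div] at hre him
  linarith

/-! ### Telescoping over the dyadic tree and the abstract square function bound. -/

namespace DyadicInterval

theorem len_leftHalf (I : DyadicInterval) : I.leftHalf.len = I.len / 2 := by
  simp only [len, leftHalf]
  rw [neg_add, zpow_add₀ (by norm_num)]
  norm_num [div_eq_mul_inv]

theorem len_rightHalf (I : DyadicInterval) : I.rightHalf.len = I.len / 2 :=
  I.len_leftHalf

/-- A dyadic interval is given by its scale and its position. -/
def equivProd : DyadicInterval ≃ ℤ × ℤ where
  toFun I := (I.scale, I.pos)
  invFun x := ⟨x.1, x.2⟩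
  left_inv _ := rfl
  right_inv _ := rfl

theorem tsum_eq_tsum_scale (F : DyadicInterval → ℝ≥0∞) :
    ∑' I, F I = ∑' j : ℤ, ∑' k : ℤ, F ⟨j, k⟩ := by
  rw [← equivProd.symm.tsum_eq, ENNReal.tsum_prod']
  rfl

theorem tsum_halves (F : DyadicInterval → ℝ≥0∞) (j : ℤ) :
    ∑' k : ℤ, (F (leftHalf ⟨j, k⟩) + F (rightHalf ⟨j, k⟩)) = ∑' k : ℤ, F ⟨j + 1, k⟩ := by
  have hu : Function.Injective (fun k : ℤ => 2 * k) := fun a b h => by simpa using h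
  have hv : Function.Injective (fun k : ℤ => 2 * k + 1) := fun a b h => by simpa using h
  have hc : IsCompl (Set.range fun k : ℤ => 2 * k) (Set.range fun k : ℤ => 2 * k + 1) := by
    simpa using Int.isCompl_even_odd
  rw [ENNReal.tsum_add]
  have h := (Summable.tsum_add_tsum_compl (s := Set.range fun k : ℤ => 2 * k)
    (f := fun k : ℤ => F ⟨j + 1, k⟩) ENNReal.summable ENNReal.summable)
  rw [hc.compl_eq] at h
  rw [← h, tsum_range (f := fun k : ℤ => F ⟨j + 1, k⟩) hu,
    tsum_range (f := fun k : ℤ => F ⟨j + 1, k⟩) hv]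
  rfl

/-- Telescoping over the scales of the dyadic tree. -/
theorem tsum_le_of_step {D Φ : DyadicInterval → ℝ≥0∞} {M : ℝ≥0∞}
    (hstep : ∀ I, D I + Φ I ≤ Φ I.leftHalf + Φ I.rightHalf)
    (hM : ∀ j : ℤ, ∑' k : ℤ, Φ ⟨j, k⟩ ≤ M) : ∑' I, D I ≤ M := by
  have hscale : ∀ j : ℤ, (∑' k : ℤ, D ⟨j, k⟩) + ∑' k : ℤ, Φ ⟨j, k⟩ ≤ ∑' k : ℤ, Φ ⟨j + 1, k⟩ := by
    intro j
    rw [← ENNReal.tsum_add, ← tsum_halves]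
    exact ENNReal.tsum_le_tsum fun k => hstep _
  have hsum : ∀ (j : ℤ) (N : ℕ), (∑ i ∈ Finset.range N, ∑' k : ℤ, D ⟨j + i, k⟩)
      + ∑' k : ℤ, Φ ⟨j, k⟩ ≤ ∑' k : ℤ, Φ ⟨j + N, k⟩ := by
    intro j N
    induction N with
    | zero => simp
    | succ N ih =>
      rw [Finset.sum_range_succ, add_comm (∑ i ∈ Finset.range N, _), add_assoc]
      refine (add_le_add_right ih _).trans ((hscale _).trans ?_)
      push_cast
      rw [add_assoc]
  rw [tsum_eq_tsum_scale, ENNReal.tsum_eq_iSup_sum]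
  refine iSup_le fun S => ?_
  obtain ⟨a, ha⟩ := S.bddBelow
  obtain ⟨b, hb⟩ := S.bddAbove
  -- A finite set of scales lies in a window [a, b], on which the one-scale inequality telescopes;
  -- the bound M does not depend on the window.
  have hsub : S ⊆ (Finset.range (b + 1 - a).toNat).image (fun i : ℕ => a + (i : ℤ)) := by
    intro j hj
    have h1 := ha hj
    have h2 := hb hj
    exact Finset.mem_image.mpr ⟨(j - a).toNat, Finset.mem_range.mpr (by omega), by omega⟩
  refine (Finset.sum_le_sum_of_subset hsub).trans ?_
  rw [Finset.sum_image (by intro x _ y _ h; simpa using h)]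
  exact le_self_add.trans ((hsum a _).trans (hM _))

/-- Square function bound: a quadratic estimate, against the averages `X` of a weight, of the
increments of a function with averages `y`. The averages `X` are comparable to the square of a
submartingale `g`. -/
theorem tsum_sq_increment_le {A : ℝ} {X g e : DyadicInterval → ℝ} {y : DyadicInterval → ℂ}
    {M : ℝ≥0∞} (hg : ∀ I, 0 < g I)
    (hX : ∀ I, X I = (X I.rightHalf + X I.leftHalf) / 2)
    (hgs : ∀ I, 2 * g I ≤ g I.rightHalf + g I.leftHalf)
    (hgX : ∀ I, g I ^ 2 ≤ X I) (hXg : ∀ I, X I ≤ A * g I ^ 2)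
    (hy : ∀ I, y I = (y I.rightHalf + y I.leftHalf) / 2)
    (hye : ∀ I, ‖y I‖ ^ 2 ≤ X I * e I)
    (hM : ∀ j : ℤ, ∑' k : ℤ, ENNReal.ofReal (len ⟨j, k⟩ * e ⟨j, k⟩) ≤ M) :
    ∑' I, ENNReal.ofReal (I.len * (‖(y I.rightHalf - y I.leftHalf) / 2‖ ^ 2 / X I))
      ≤ ENNReal.ofReal (386 * A) * M := by
  have hX0 : ∀ I, 0 < X I := fun I => lt_of_lt_of_le (by have := hg I; positivity) (hgX I)
  have hA : 1 ≤ A := by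
    have h1 := (hgX ⟨0, 0⟩).trans (hXg ⟨0, 0⟩)
    have h2 : 0 < g ⟨0, 0⟩ ^ 2 := by have := hg ⟨0, 0⟩; positivity
    by_contra! h
    nlinarith
  set s := √A with hs
  have hs2 : s ^ 2 = A := Real.sq_sqrt (by linarith)
  have hs1 : 1 ≤ s := Real.one_le_sqrt.mpr hA
  have ha2 : ∀ I, √(X I) ^ 2 = X I := fun I => Real.sq_sqrt (hX0 I).le
  have hga : ∀ I, g I ≤ √(X I) := fun I => Real.le_sqrt_of_sq_le (hgX I)
  have has : ∀ I, √(X I) ≤ s * g I := fun I => by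
    rw [Real.sqrt_le_left (by have := hg I; positivity), mul_pow, hs2]
    exact hXg I
  -- The multiple of X is additive, so the drop is that of the potential; it makes ω comparable to
  -- X, between 4AX and 8AX.
  set ω : DyadicInterval → ℝ := fun I => 4 * A * X I + buckleyPotential s √(X I) (g I) with hω
  have hωl : ∀ I, 4 * A * X I ≤ ω I := fun I => by
    have := buckleyPotential_nonneg (s := s) (by linarith) (hg I).le (hga I)
    simp only [hω]; linarith
  have hωu : ∀ I, ω I ≤ 8 * A * X I := fun I => by
    have := buckleyPotential_le hs1 (hg I).le (hga I)
    rw [ha2, hs2] at this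
    simp only [hω]; linarith
  have hω0 : ∀ I, 0 < ω I := fun I =>
    lt_of_lt_of_le (by have := hX0 I; positivity) (hωl I)
  set Ψ : DyadicInterval → ℝ := fun I =>
    I.len * (2 * (‖y I‖ ^ 2 / X I) + 1536 * A ^ 2 * (‖y I‖ ^ 2 / ω I)) with hΨ
  have hΨ0 : ∀ I, 0 ≤ Ψ I := fun I => by
    have := hX0 I
    have := hω0 I
    have := I.len_pos
    positivity
  have hΨe : ∀ I, Ψ I ≤ 386 * A * (I.len * e I) := fun I => by
    have h1 : ‖y I‖ ^ 2 / X I ≤ e I := by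
      rw [div_le_iff₀ (hX0 I), mul_comm]; exact hye I
    have h2 : ‖y I‖ ^ 2 / ω I ≤ ‖y I‖ ^ 2 / X I / (4 * A) := by
      rw [div_div, mul_comm (X I)]
      exact div_le_div_of_nonneg_left (by positivity) (by have := hX0 I; positivity) (hωl I)
    have h3 : 0 ≤ e I := le_trans (by have := hX0 I; positivity) h1
    -- The lower bound ω ≥ 4AX reduces A² to A. With the term 2e and A ≥ 1 this gives 386 = 2 + 384.
    have h4 : 1536 * A ^ 2 * (‖y I‖ ^ 2 / ω I) ≤ 384 * A * e I := by
      calc 1536 * A ^ 2 * (‖y I‖ ^ 2 / ω I) ≤ 1536 * A ^ 2 * (e I / (4 * A)) := by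
            exact mul_le_mul_of_nonneg_left (h2.trans (by gcongr)) (by positivity)
        _ = _ := by field_simp; ring
    have h5 : e I ≤ A * e I := le_mul_of_one_le_left h3 hA
    have := I.len_pos
    calc Ψ I ≤ I.len * (386 * A * e I) := by
          simp only [hΨ]; gcongr; linarith
      _ = _ := by ring
  have key := tsum_le_of_step (M := ENNReal.ofReal (386 * A) * M)
    (D := fun I => ENNReal.ofReal (I.len * (‖(y I.rightHalf - y I.leftHalf) / 2‖ ^ 2 / X I)))
    (Φ := fun I => ENNReal.ofReal (Ψ I)) ?_ ?_
  · exact key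
  · intro I
    have hl := I.len_pos
    rw [← ENNReal.ofReal_add (by have := hX0 I; positivity) (hΨ0 I),
      ← ENNReal.ofReal_add (hΨ0 _) (hΨ0 _)]
    apply ENNReal.ofReal_le_ofReal
    have hb := buckleyPotential_step (s := s) (by linarith) (Real.sqrt_pos.mpr (hX0 I))
      (Real.sqrt_nonneg (X I.rightHalf)) (Real.sqrt_nonneg (X I.leftHalf)) (hg I)
      (by simpa only [ha2] using hX I) (hgs I) (has I)
    simp only [ha2] at hb
    have hst := square_step (B := A) (hX0 I) (hX0 I.rightHalf) (hX0 I.leftHalf) (hω0 I.rightHalf)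
      (hω0 I.leftHalf) (hX I) (hω0 I) (hωu I) (by
        refine hb.trans (le_of_eq ?_)
        simp only [hω]
        rw [hX I]
        ring) (hy I)
    simp only [hΨ, len_leftHalf, len_rightHalf]
    have := mul_le_mul_of_nonneg_left hst hl.le
    linarith
  · intro j
    calc ∑' k : ℤ, ENNReal.ofReal (Ψ ⟨j, k⟩)
        ≤ ∑' k : ℤ, ENNReal.ofReal (386 * A) * ENNReal.ofReal (len ⟨j, k⟩ * e ⟨j, k⟩) := by
          refine ENNReal.tsum_le_tsum fun k => ?_
          rw [← ENNReal.ofReal_mul (by positivity)]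
          exact ENNReal.ofReal_le_ofReal (hΨe _)
      _ = ENNReal.ofReal (386 * A) * ∑' k : ℤ, ENNReal.ofReal (len ⟨j, k⟩ * e ⟨j, k⟩) :=
          ENNReal.tsum_mul_left
      _ ≤ _ := by gcongr; exact hM j

end DyadicInterval

/-! ### Integrals and averages over dyadic intervals. -/

namespace DyadicInterval

theorem measurableSet_toSet (I : DyadicInterval) : MeasurableSet I.toSet := measurableSet_Ico

theorem volume_toSet (I : DyadicInterval) : volume I.toSet = ENNReal.ofReal I.len := by
  rw [toSet, Real.volume_Ico]
  congr 1
  ring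

theorem volume_toSet_ne_zero (I : DyadicInterval) : volume I.toSet ≠ 0 := by
  rw [volume_toSet]
  simpa using I.len_pos

theorem volume_toSet_ne_top (I : DyadicInterval) : volume I.toSet ≠ ∞ := by
  rw [volume_toSet]
  exact ENNReal.ofReal_ne_top

theorem leftHalf_union_rightHalf (I : DyadicInterval) :
    I.leftHalf.toSet ∪ I.rightHalf.toSet = I.toSet := by
  have hl := I.len_pos
  simp only [toSet, len_leftHalf, len_rightHalf]
  simp only [leftHalf, rightHalf]
  push_cast
  rw [Set.Ico_union_Ico_eq_Ico (by nlinarith) (by nlinarith)]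
  congr 1 <;> ring

theorem disjoint_halves (I : DyadicInterval) :
    Disjoint I.leftHalf.toSet I.rightHalf.toSet := by
  simp only [toSet, len_leftHalf, len_rightHalf]
  simp only [leftHalf, rightHalf]
  push_cast
  exact Set.Ico_disjoint_Ico_same

theorem lintegral_halves (f : ℝ → ℝ≥0∞) (I : DyadicInterval) :
    ∫⁻ x in I.toSet, f x = (∫⁻ x in I.rightHalf.toSet, f x) + ∫⁻ x in I.leftHalf.toSet, f x := by
  rw [← leftHalf_union_rightHalf, lintegral_union (measurableSet_toSet _) (disjoint_halves I),
    add_comm]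

theorem integral_halves {f : ℝ → ℂ} (hf : ∀ I : DyadicInterval, IntegrableOn f I.toSet)
    (I : DyadicInterval) :
    ∫ x in I.toSet, f x = (∫ x in I.rightHalf.toSet, f x) + ∫ x in I.leftHalf.toSet, f x := by
  rw [← leftHalf_union_rightHalf, setIntegral_union (disjoint_halves I) (measurableSet_toSet _)
    (hf _) (hf _), add_comm]

theorem tsum_lintegral_scale (f : ℝ → ℝ≥0∞) (j : ℤ) :
    ∑' k : ℤ, ∫⁻ x in toSet ⟨j, k⟩, f x = ∫⁻ x, f x := by
  have hp : (0 : ℝ) < len ⟨j, 0⟩ := len_pos _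
  have hs : ∀ k : ℤ, toSet ⟨j, k⟩ = Set.Ico (k • len ⟨j, 0⟩) ((k + 1) • len ⟨j, 0⟩) := by
    intro k
    simp [toSet, len]
  rw [← lintegral_iUnion (fun k => measurableSet_toSet _)]
  · simp_rw [hs]
    rw [iUnion_Ico_zsmul hp, setLIntegral_univ]
  · intro k l hkl
    simp only [Function.onFun, hs]
    exact Set.pairwise_disjoint_Ico_zsmul _ hkl

/-- Two neighbours are needed because an integer is the left endpoint of its unit interval. This
passes from integrability on dyadic intervals to local integrability. -/
theorem toSet_neighborhood (x : ℝ) :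
    toSet ⟨0, ⌊x⌋ - 1⟩ ∪ toSet ⟨0, ⌊x⌋⟩ ∈ 𝓝 x := by
  have h : Set.Ioo ((⌊x⌋ : ℝ) - 1) (⌊x⌋ + 1) ∈ 𝓝 x :=
    Ioo_mem_nhds (by linarith [Int.floor_le x]) (Int.lt_floor_add_one x)
  refine mem_of_superset h fun y hy => ?_
  simp only [toSet, len, Set.mem_union, Set.mem_Ico]
  push_cast
  simp only [neg_zero, zpow_zero, mul_one]
  rcases lt_or_ge y ⌊x⌋ with h | h
  · left; exact ⟨hy.1.le, by linarith⟩
  · right; exact ⟨h, hy.2⟩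

end DyadicInterval

open DyadicInterval

theorem lavg_eq (u : ℝ → ℝ) (I : DyadicInterval) :
    lavg u I = (∫⁻ x in I.toSet, ENNReal.ofReal (u x)) / ENNReal.ofReal I.len := by
  rw [lavg, setLAverage_eq, volume_toSet]

theorem lavg_eq_lintegral (u : ℝ → ℝ) (I : DyadicInterval) :
    lavg u I = ∫⁻ x, ENNReal.ofReal (u x) ∂((volume I.toSet)⁻¹ • volume.restrict I.toSet) := by
  rw [lavg, setLAverage_eq']

theorem isProbabilityMeasure_avg (I : DyadicInterval) :
    IsProbabilityMeasure ((volume I.toSet)⁻¹ • volume.restrict I.toSet) := by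
  constructor
  simp [ENNReal.inv_mul_cancel I.volume_toSet_ne_zero I.volume_toSet_ne_top]

theorem avg_absolutelyContinuous (I : DyadicInterval) :
    ((volume I.toSet)⁻¹ • volume.restrict I.toSet) ≪ (volume : Measure ℝ) :=
  (Measure.smul_absolutelyContinuous).trans Measure.absolutelyContinuous_restrict

theorem ofReal_len_mul_lavg (u : ℝ → ℝ) (I : DyadicInterval) :
    ENNReal.ofReal I.len * lavg u I = ∫⁻ x in I.toSet, ENNReal.ofReal (u x) := by
  rw [lavg_eq, ENNReal.mul_div_cancel (by simpa using I.len_pos) ENNReal.ofReal_ne_top]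

theorem lavg_halves (u : ℝ → ℝ) (I : DyadicInterval) :
    lavg u I = (lavg u I.rightHalf + lavg u I.leftHalf) / 2 := by
  simp only [lavg_eq, len_leftHalf, len_rightHalf]
  rw [lintegral_halves, ← ENNReal.add_div, ENNReal.ofReal_div_of_pos two_pos]
  simp only [div_eq_mul_inv]
  rw [ENNReal.mul_inv (by simp) (by simp), inv_inv]
  rw [mul_assoc, mul_assoc]
  congr 1
  rw [show ENNReal.ofReal 2 = 2 by norm_num, ENNReal.mul_inv_cancel (by simp) (by simp), mul_one]

theorem lavg_congr {u v : ℝ → ℝ} (h : ∀ᵐ x ∂(volume : Measure ℝ), u x = v x)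
    (I : DyadicInterval) : lavg u I = lavg v I := by
  rw [lavg_eq_lintegral, lavg_eq_lintegral]
  refine lintegral_congr_ae ?_
  filter_upwards [(avg_absolutelyContinuous I).ae_le h] with x hx
  rw [hx]

theorem lavg_one (I : DyadicInterval) : lavg (fun _ => 1) I = 1 := by
  have := isProbabilityMeasure_avg I
  rw [lavg_eq_lintegral]
  simp

/-! ### Power means of a weight: Jensen and Hölder. -/

namespace IsWeight

variable {w : ℝ → ℝ}

theorem aestronglyMeasurable (hw : IsWeight w) : AEStronglyMeasurable w volume :=
  hw.locallyIntegrable.aestronglyMeasurable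

theorem integrableOn (hw : IsWeight w) (I : DyadicInterval) : IntegrableOn w I.toSet :=
  (hw.locallyIntegrable.integrableOn_isCompact isCompact_Icc).mono_set Set.Ico_subset_Icc_self

theorem lavg_lt_top (hw : IsWeight w) (I : DyadicInterval) : lavg w I < ∞ := by
  rw [lavg_eq]
  refine ENNReal.div_lt_top ?_ (by simpa using I.len_pos)
  refine ne_of_lt (lt_of_le_of_lt (lintegral_mono fun x => ?_) (hw.integrableOn I).2)
  exact Real.ofReal_le_enorm (w x)

theorem lavg_ne_zero_of_ae_pos {u : ℝ → ℝ} (hm : AEStronglyMeasurable u volume)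
    (hpos : ∀ᵐ x ∂(volume : Measure ℝ), 0 < u x) (I : DyadicInterval) : lavg u I ≠ 0 := by
  have hp := isProbabilityMeasure_avg I
  rw [lavg_eq_lintegral]
  intro h0
  rw [lintegral_eq_zero_iff' (by
    exact (hm.aemeasurable.ennreal_ofReal).mono_ac (avg_absolutelyContinuous I))] at h0
  have h1 := (avg_absolutelyContinuous I).ae_le hpos
  have : ∀ᵐ x ∂((volume I.toSet)⁻¹ • volume.restrict I.toSet), False := by
    filter_upwards [h0, h1] with x hx hx'
    simp only [Pi.zero_apply, ENNReal.ofReal_eq_zero] at hx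
    linarith
  exact this.exists.elim fun _ hx => hx

theorem lavg_ne_zero (hw : IsWeight w) (I : DyadicInterval) : lavg w I ≠ 0 :=
  lavg_ne_zero_of_ae_pos hw.aestronglyMeasurable hw.ae_pos I

theorem aestronglyMeasurable_rpow (hw : IsWeight w) (s : ℝ) :
    AEStronglyMeasurable (fun x => w x ^ s) volume :=
  (hw.aestronglyMeasurable.aemeasurable.pow_const s).aestronglyMeasurable

theorem rpow_ae_pos (hw : IsWeight w) (s : ℝ) :
    ∀ᵐ x ∂(volume : Measure ℝ), 0 < w x ^ s := by
  filter_upwards [hw.ae_pos] with x hx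
  exact Real.rpow_pos_of_pos hx s

theorem of_lavg_lt_top {u : ℝ → ℝ} (hm : AEStronglyMeasurable u volume)
    (hpos : ∀ᵐ x ∂(volume : Measure ℝ), 0 < u x) (h : ∀ I, lavg u I < ∞) : IsWeight u := by
  have hI : ∀ I : DyadicInterval, IntegrableOn u I.toSet := by
    intro I
    refine ⟨hm.restrict, ?_⟩
    rw [hasFiniteIntegral_iff_ofReal (ae_restrict_of_ae (hpos.mono fun x hx => hx.le)),
      ← ofReal_len_mul_lavg]
    exact ENNReal.mul_lt_top ENNReal.ofReal_lt_top (h I)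
  exact ⟨fun x => ⟨_, toSet_neighborhood x, (hI _).union (hI _)⟩, hpos⟩

theorem lavg_rpow_eq (hw : IsWeight w) (s : ℝ) (I : DyadicInterval) :
    lavg (fun x => w x ^ s) I = ∫⁻ x, ENNReal.ofReal (w x) ^ s
      ∂((volume I.toSet)⁻¹ • volume.restrict I.toSet) := by
  rw [lavg_eq_lintegral]
  refine lintegral_congr_ae ?_
  filter_upwards [(avg_absolutelyContinuous I).ae_le hw.ae_pos] with x hx
  rw [ENNReal.ofReal_rpow_of_pos hx]

theorem rpow_rpow_ae (hw : IsWeight w) (s r : ℝ) :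
    ∀ᵐ x ∂(volume : Measure ℝ), (w x ^ s) ^ r = w x ^ (s * r) := by
  filter_upwards [hw.ae_pos] with x hx
  rw [Real.rpow_mul hx.le]

theorem aemeasurable_ofReal_avg (hw : IsWeight w) (I : DyadicInterval) :
    AEMeasurable (fun x => ENNReal.ofReal (w x))
      ((volume I.toSet)⁻¹ • volume.restrict I.toSet) :=
  (hw.aestronglyMeasurable.aemeasurable.ennreal_ofReal).mono_ac (avg_absolutelyContinuous I)

/-- Monotonicity of power means. -/
theorem lavg_rpow_rpow_le (hw : IsWeight w) {r s : ℝ} (hr : 0 < r) (hrs : r ≤ s)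
    (I : DyadicInterval) :
    lavg (fun x => w x ^ r) I ^ (1 / r) ≤ lavg (fun x => w x ^ s) I ^ (1 / s) := by
  have := isProbabilityMeasure_avg I
  have h := eLpNorm'_le_eLpNorm'_of_exponent_le hr hrs
    ((volume I.toSet)⁻¹ • volume.restrict I.toSet)
    (f := fun x => ENNReal.ofReal (w x)) (hw.aemeasurable_ofReal_avg I).aestronglyMeasurable
  simpa only [eLpNorm', enorm_eq_self, ← hw.lavg_rpow_eq] using h

theorem lavg_rpow_one (I : DyadicInterval) : lavg (fun x => w x ^ (1 : ℝ)) I = lavg w I := by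
  simp

theorem lavg_rpow_le (hw : IsWeight w) {s : ℝ} (hs0 : 0 ≤ s) (hs1 : s ≤ 1)
    (I : DyadicInterval) : lavg (fun x => w x ^ s) I ≤ lavg w I ^ s := by
  rcases hs0.eq_or_lt with rfl | hs
  · simp [lavg_one]
  · have h := hw.lavg_rpow_rpow_le hs hs1 I
    rw [lavg_rpow_one, div_one, ENNReal.rpow_one] at h
    have h2 := ENNReal.rpow_le_rpow h hs.le
    rwa [← ENNReal.rpow_mul, one_div_mul_cancel hs.ne', ENNReal.rpow_one] at h2

theorem rpow_lavg_le (hw : IsWeight w) {s : ℝ} (hs1 : 1 ≤ s) (I : DyadicInterval) :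
    lavg w I ^ s ≤ lavg (fun x => w x ^ s) I := by
  have hs : 0 < s := by linarith
  have h := hw.lavg_rpow_rpow_le one_pos hs1 I
  rw [lavg_rpow_one, div_one, ENNReal.rpow_one] at h
  have h2 := ENNReal.rpow_le_rpow h hs.le
  rwa [← ENNReal.rpow_mul, one_div_mul_cancel hs.ne', ENNReal.rpow_one] at h2

/-- Hölder's inequality: each product in the Muckenhoupt characteristic is at least one. -/
theorem one_le_lavg_mul (hw : IsWeight w) {q : ℝ} (hq : 1 < q) (I : DyadicInterval) :
    1 ≤ lavg w I * lavg (fun x => w x ^ (-1 / (q - 1))) I ^ (q - 1) := by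
  have hp := isProbabilityMeasure_avg I
  have hq0 : 0 < q := by linarith
  have hq1 : 0 < q - 1 := by linarith
  have hm := hw.aemeasurable_ofReal_avg I
  have hc : q.HolderConjugate (q / (q - 1)) := by
    have := Real.HolderConjugate.conjExponent hq
    simpa [Real.conjExponent] using this
  have h := ENNReal.lintegral_mul_le_Lp_mul_Lq
    ((volume I.toSet)⁻¹ • volume.restrict I.toSet) hc
    (f := fun x => ENNReal.ofReal (w x) ^ (1 / q)) (g := fun x => ENNReal.ofReal (w x) ^ (-(1 / q)))
    (hm.pow_const _) (hm.pow_const _)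
  have hae := (avg_absolutelyContinuous I).ae_le hw.ae_pos
  have e1 : ∫⁻ x, ((fun x => ENNReal.ofReal (w x) ^ (1 / q))
      * (fun x => ENNReal.ofReal (w x) ^ (-(1 / q)))) x
      ∂((volume I.toSet)⁻¹ • volume.restrict I.toSet) = 1 := by
    rw [← lintegral_one.trans hp.measure_univ]
    refine lintegral_congr_ae ?_
    filter_upwards [hae] with x hx
    simp only [Pi.mul_apply]
    rw [← ENNReal.rpow_add _ _ (by simpa using hx) ENNReal.ofReal_ne_top]
    simp
  rw [e1] at h
  simp only [← ENNReal.rpow_mul] at h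
  rw [show 1 / q * q = 1 by field_simp, show -(1 / q) * (q / (q - 1)) = -1 / (q - 1) by field_simp,
    ← hw.lavg_rpow_eq, ← hw.lavg_rpow_eq, lavg_rpow_one] at h
  have h2 := ENNReal.rpow_le_rpow h hq0.le
  rwa [ENNReal.one_rpow, ENNReal.mul_rpow_of_nonneg _ _ hq0.le, ← ENNReal.rpow_mul,
    ← ENNReal.rpow_mul, show 1 / q * q = 1 by field_simp,
    show 1 / (q / (q - 1)) * q = q - 1 by field_simp, ENNReal.rpow_one] at h2

end IsWeight

/-! ### Relations between the characteristics. -/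

theorem MemC.isWeight_rpow {s : ℝ} {w : ℝ → ℝ} (h : MemC s w) : IsWeight (fun x => w x ^ s) := by
  refine IsWeight.of_lavg_lt_top (h.isWeight.aestronglyMeasurable_rpow s)
    (h.isWeight.rpow_ae_pos s) fun I => ?_
  by_contra hI
  have h1 : lavg (fun x => w x ^ s) I * lavg w I ^ (-s) ≤ cChar s w :=
    le_iSup (fun I => lavg (fun x => w x ^ s) I * lavg w I ^ (-s)) I
  have h2 : lavg w I ^ (-s) ≠ 0 :=
    (ENNReal.rpow_pos (pos_iff_ne_zero.mpr (h.isWeight.lavg_ne_zero I))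
      (h.isWeight.lavg_lt_top I).ne).ne'
  rw [not_lt_top_iff.mp hI, ENNReal.top_mul h2] at h1
  exact absurd h.char_lt_top (not_lt.mpr h1)

theorem lavg_rpow_le_cChar_mul {s : ℝ} {w : ℝ → ℝ} (hw : IsWeight w) (I : DyadicInterval) :
    lavg (fun x => w x ^ s) I ≤ cChar s w * lavg w I ^ s := by
  have h1 : lavg (fun x => w x ^ s) I * lavg w I ^ (-s) ≤ cChar s w :=
    le_iSup (fun I => lavg (fun x => w x ^ s) I * lavg w I ^ (-s)) I
  calc lavg (fun x => w x ^ s) I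
      = lavg (fun x => w x ^ s) I * lavg w I ^ (-s) * lavg w I ^ s := by
        rw [mul_assoc, ← ENNReal.rpow_add _ _ (hw.lavg_ne_zero I) (hw.lavg_lt_top I).ne]
        simp
    _ ≤ _ := by gcongr

theorem lavg_mul_le_apChar (q : ℝ) (w : ℝ → ℝ) (I : DyadicInterval) :
    lavg w I * lavg (fun x => w x ^ (-1 / (q - 1))) I ^ (q - 1) ≤ apChar q w :=
  le_iSup (fun I => lavg w I * lavg (fun x => w x ^ (-1 / (q - 1))) I ^ (q - 1)) I

theorem MemAp.isWeight_dual {q : ℝ} {w : ℝ → ℝ} (h : MemAp q w) :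
    IsWeight fun x => w x ^ (-1 / (q - 1)) := by
  have hw := h.isWeight
  have hq1 : 0 < q - 1 := by have := h.one_lt; linarith
  refine IsWeight.of_lavg_lt_top (hw.aestronglyMeasurable_rpow _) (hw.rpow_ae_pos _) fun I => ?_
  by_contra hI
  have h1 := lavg_mul_le_apChar q w I
  rw [not_lt_top_iff.mp hI, ENNReal.top_rpow_of_pos hq1, ENNReal.mul_top (hw.lavg_ne_zero I)] at h1
  exact absurd h.char_lt_top (not_lt.mpr h1)

theorem one_le_apChar {q : ℝ} {w : ℝ → ℝ} (hw : IsWeight w) (hq : 1 < q) : 1 ≤ apChar q w :=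
  (hw.one_le_lavg_mul hq ⟨0, 0⟩).trans
    (lavg_mul_le_apChar q w _)

theorem cChar_le_one {s : ℝ} {w : ℝ → ℝ} (hw : IsWeight w) (hs0 : 0 ≤ s) (hs1 : s ≤ 1) :
    cChar s w ≤ 1 := by
  refine iSup_le fun I => ?_
  calc lavg (fun x => w x ^ s) I * lavg w I ^ (-s) ≤ lavg w I ^ s * lavg w I ^ (-s) := by
        gcongr; exact hw.lavg_rpow_le hs0 hs1 I
    _ = 1 := by
        rw [← ENNReal.rpow_add _ _ (hw.lavg_ne_zero I) (hw.lavg_lt_top I).ne]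
        simp

/-- The Muckenhoupt characteristic of a power of a weight, with the inner exponent simplified. -/
theorem apChar_rpow {s q : ℝ} {w : ℝ → ℝ} (hw : IsWeight w) :
    apChar q (fun x => w x ^ s) = ⨆ I : DyadicInterval, lavg (fun x => w x ^ s) I
      * lavg (fun x => w x ^ (s * (-1 / (q - 1)))) I ^ (q - 1) := by
  unfold apChar
  refine iSup_congr fun I => ?_
  rw [lavg_congr (hw.rpow_rpow_ae s _)]

/-- Jensen's inequality is applied both to the weight and to its dual weight, since the dual of w^s
is the s-th power of the dual of w. -/
theorem apChar_rpow_le {s q : ℝ} {w : ℝ → ℝ} (hw : IsWeight w) (hs0 : 0 ≤ s) (hs1 : s ≤ 1)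
    (hwq : MemAp q w) : apChar q (fun x => w x ^ s) ≤ apChar q w ^ s := by
  have hq1 : 0 < q - 1 := by have := hwq.one_lt; linarith
  have hσ := hwq.isWeight_dual
  rw [apChar_rpow hw]
  refine iSup_le fun I => ?_
  have e : lavg (fun x => w x ^ (s * (-1 / (q - 1)))) I
      = lavg (fun x => (w x ^ (-1 / (q - 1))) ^ s) I := by
    rw [lavg_congr (hw.rpow_rpow_ae _ s), mul_comm]
  rw [e]
  calc lavg (fun x => w x ^ s) I * lavg (fun x => (w x ^ (-1 / (q - 1))) ^ s) I ^ (q - 1)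
      ≤ lavg w I ^ s * (lavg (fun x => w x ^ (-1 / (q - 1))) I ^ s) ^ (q - 1) := by
        gcongr
        · exact hw.lavg_rpow_le hs0 hs1 I
        · exact hσ.lavg_rpow_le hs0 hs1 I
    _ = (lavg w I * lavg (fun x => w x ^ (-1 / (q - 1))) I ^ (q - 1)) ^ s := by
        rw [ENNReal.mul_rpow_of_nonneg _ _ hs0, ← ENNReal.rpow_mul, ← ENNReal.rpow_mul,
          mul_comm s]
    _ ≤ _ := by
        gcongr
        exact lavg_mul_le_apChar q w I

/-- The index is the one for which w^s and w have the same dual weight. Only the average of w^s has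
to be compared with that of w, at the cost of `cChar s w`. -/
theorem apChar_rpow_le_cChar_mul {s p : ℝ} {w : ℝ → ℝ} (hw : IsWeight w) (hs : 0 < s)
    (hp : 1 < p) :
    apChar (s * (p - 1) + 1) (fun x => w x ^ s) ≤ cChar s w * apChar p w ^ s := by
  have hp1 : 0 < p - 1 := by linarith
  rw [apChar_rpow hw]
  refine iSup_le fun I => ?_
  rw [show s * (-1 / (s * (p - 1) + 1 - 1)) = -1 / (p - 1) by field_simp; simp,
    show s * (p - 1) + 1 - 1 = (p - 1) * s by ring]
  calc lavg (fun x => w x ^ s) I * lavg (fun x => w x ^ (-1 / (p - 1))) I ^ ((p - 1) * s)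
      ≤ cChar s w * lavg w I ^ s * lavg (fun x => w x ^ (-1 / (p - 1))) I ^ ((p - 1) * s) := by
        gcongr; exact lavg_rpow_le_cChar_mul hw I
    _ = cChar s w * (lavg w I * lavg (fun x => w x ^ (-1 / (p - 1))) I ^ (p - 1)) ^ s := by
        rw [ENNReal.mul_rpow_of_nonneg _ _ hs.le, ← ENNReal.rpow_mul, mul_assoc]
    _ ≤ _ := by
        gcongr
        exact lavg_mul_le_apChar p w I

/-- At index 1 - s the dual weight of w^s is w itself, so the two suprema agree term by term. -/
theorem apChar_rpow_eq_cChar {s : ℝ} {w : ℝ → ℝ} (hw : IsWeight w) (hs : s < 0) :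
    apChar (1 - s) (fun x => w x ^ s) = cChar s w := by
  rw [apChar_rpow hw, cChar]
  refine iSup_congr fun I => ?_
  rw [show s * (-1 / (1 - s - 1)) = 1 by
    rw [show 1 - s - 1 = -s by ring, neg_div_neg_eq, mul_one_div_cancel hs.ne],
    IsWeight.lavg_rpow_one, show 1 - s - 1 = -s by ring]

/-- At index 1 - 1/s the dual weight of w is w^s. The positive power -s commutes with the supremum
because it is an order isomorphism of [0, ∞]. -/
theorem cChar_eq_apChar_rpow {s : ℝ} {w : ℝ → ℝ} (hs : s < 0) :
    cChar s w = apChar (1 - 1 / s) w ^ (-s) := by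
  have hs' : 0 < -s := by linarith
  have h := (ENNReal.orderIsoRpow (-s) hs').map_iSup (fun I : DyadicInterval =>
    lavg w I * lavg (fun x => w x ^ (-1 / ((1 - 1 / s) - 1))) I ^ ((1 - 1 / s) - 1))
  simp only [ENNReal.orderIsoRpow_apply] at h
  rw [apChar, h, cChar]
  refine iSup_congr fun I => ?_
  rw [ENNReal.mul_rpow_of_nonneg _ _ hs'.le, ← ENNReal.rpow_mul,
    show (1 - 1 / s - 1) * -s = 1 by have := hs.ne; field_simp; ring,
    show -1 / (1 - 1 / s - 1) = s by have := hs.ne; field_simp; ring, ENNReal.rpow_one, mul_comm]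

/-! ### Blocks of descendants. -/

namespace DyadicInterval

theorem sum_range_two_mul {M : Type*} [AddCommMonoid M] (F : ℕ → M) (N : ℕ) :
    ∑ i ∈ Finset.range (N * 2), F i = ∑ i ∈ Finset.range N, (F (2 * i) + F (2 * i + 1)) := by
  induction N with
  | zero => simp
  | succ N ih =>
    rw [Nat.succ_mul, Finset.sum_range_succ, Finset.sum_range_succ, ih, Finset.sum_range_succ,
      mul_comm N 2, add_assoc]

theorem sum_descendants {M : Type*} [AddCommMonoid M] (F : DyadicInterval → M)
    (L : DyadicInterval) (n : ℕ) :
    ∑ J ∈ L.descendants n, F J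
      = ∑ i ∈ Finset.range (2 ^ n), F ⟨L.scale + n, 2 ^ n * L.pos + i⟩ := by
  rw [descendants, Finset.sum_map]
  rfl

theorem sum_descendants_of_additive {M : Type*} [AddCommMonoid M] {F : DyadicInterval → M}
    (hF : ∀ I, F I = F I.rightHalf + F I.leftHalf) (L : DyadicInterval) (n : ℕ) :
    ∑ J ∈ L.descendants n, F J = F L := by
  induction n with
  | zero => simp [sum_descendants]
  | succ n ih =>
    rw [← ih, sum_descendants, sum_descendants, pow_succ, sum_range_two_mul]
    refine Finset.sum_congr rfl fun i _ => ?_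
    rw [hF ⟨L.scale + n, 2 ^ n * L.pos + i⟩, add_comm (F (rightHalf _))]
    congr 2
    · ext
      · simp only [leftHalf]
        push_cast
        ring
      · simp only [leftHalf]
        push_cast
        ring
    · ext
      · simp only [rightHalf]
        push_cast
        ring
      · simp only [rightHalf]
        push_cast
        ring

/-- Each interval has only one n-th ancestor, so nothing is counted twice. -/
theorem tsum_sum_descendants_le (F : DyadicInterval → ℝ≥0∞) (n : ℕ) :
    ∑' L : DyadicInterval, ∑ J ∈ L.descendants n, F J ≤ ∑' J, F J := by
  have hinj : Function.Injective (fun x : DyadicInterval × Fin (2 ^ n) =>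
      (⟨x.1.scale + n, 2 ^ n * x.1.pos + (x.2 : ℕ)⟩ : DyadicInterval)) := by
    rintro ⟨⟨j, k⟩, i, hi⟩ ⟨⟨j', k'⟩, i', hi'⟩ h
    simp only [DyadicInterval.mk.injEq, add_left_inj] at h
    obtain ⟨rfl, h⟩ := h
    have hz : (i : ℤ) < 2 ^ n := by exact_mod_cast hi
    have hz' : (i' : ℤ) < 2 ^ n := by exact_mod_cast hi'
    have hp : (0 : ℤ) < 2 ^ n := by positivity
    have e1 : k = k' := by
      have := congrArg (· / (2 ^ n : ℤ)) h
      simpa [Int.add_ediv_of_dvd_left, Int.mul_ediv_cancel_left _ hp.ne',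
        Int.ediv_eq_zero_of_lt (Int.natCast_nonneg _) hz,
        Int.ediv_eq_zero_of_lt (Int.natCast_nonneg _) hz'] using this
    subst e1
    have : i = i' := by simpa using h
    subst this
    rfl
  refine le_trans (le_of_eq ?_) (ENNReal.tsum_comp_le_tsum_of_injective hinj F)
  rw [ENNReal.tsum_prod']
  refine tsum_congr fun L => ?_
  rw [sum_descendants, tsum_fintype, ← Fin.sum_univ_eq_sum_range
    (fun i => F ⟨L.scale + n, 2 ^ n * L.pos + i⟩)]

/-- The sum over `J ∈ 𝒟ₙ(L)` of the increments of an additive interval function. -/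
def haarBlock (G : DyadicInterval → ℂ) (n : ℕ) (L : DyadicInterval) : ℂ :=
  ∑ J ∈ L.descendants n, (G J.rightHalf - G J.leftHalf)

/-- The estimate for blocks of increments follows from the one for single increments. -/
theorem tsum_haarBlock_le {X : DyadicInterval → ℝ} {G : DyadicInterval → ℂ} (n : ℕ)
    (hX0 : ∀ I, 0 < X I) (hX : ∀ I, X I = (X I.rightHalf + X I.leftHalf) / 2) :
    ∑' L, ENNReal.ofReal (‖haarBlock G n L‖ ^ 2 / (L.len * X L))
      ≤ ∑' J, ENNReal.ofReal (‖G J.rightHalf - G J.leftHalf‖ ^ 2 / (J.len * X J)) := by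
  refine le_trans (ENNReal.tsum_le_tsum fun L => ?_) (tsum_sum_descendants_le _ n)
  have hpos : ∀ J : DyadicInterval, 0 < J.len * X J := fun J => mul_pos J.len_pos (hX0 J)
  rw [← ENNReal.ofReal_sum_of_nonneg fun J _ => div_nonneg (sq_nonneg _) (hpos J).le]
  apply ENNReal.ofReal_le_ofReal
  have hadd := sum_descendants_of_additive (F := fun J => J.len * X J) (fun I => by
    simp only [len_leftHalf, len_rightHalf]
    rw [hX I]
    ring) L n
  calc ‖haarBlock G n L‖ ^ 2 / (L.len * X L)
      ≤ (∑ J ∈ L.descendants n, ‖G J.rightHalf - G J.leftHalf‖) ^ 2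
          / ∑ J ∈ L.descendants n, J.len * X J := by
        rw [hadd]
        have := hpos L
        gcongr
        exact norm_sum_le _ _
    _ ≤ _ := Finset.sq_sum_div_le_sum_sq_div _ _ fun J _ => hpos J

end DyadicInterval

/-! ### The weighted square function estimate. -/

section SquareFunction

theorem lintegral_enorm_sq_eq (h : ℝ → ℂ) :
    ∫⁻ x, ‖h x‖ₑ ^ 2 = eLpNorm h 2 volume ^ 2 := by
  have := eLpNorm_nnreal_pow_eq_lintegral (f := h) (μ := volume) (p := 2) two_ne_zero
  simpa using this.symm

/-- Cauchy-Schwarz. In the application ρ = w^t and v = w^{2t}, where ρ² = v holds only where w is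
positive, hence the almost everywhere hypothesis. -/
theorem enorm_integral_mul_sq_le {ρ v : ℝ → ℝ} {h : ℝ → ℂ}
    (hρ : AEStronglyMeasurable ρ volume) (hρv : ∀ᵐ x ∂(volume : Measure ℝ), ρ x ^ 2 = v x)
    (hh : AEStronglyMeasurable h volume) (I : DyadicInterval) :
    ‖∫ x in I.toSet, (ρ x : ℂ) * h x‖ₑ ^ 2 ≤
      (∫⁻ x in I.toSet, ENNReal.ofReal (v x)) * ∫⁻ x in I.toSet, ‖h x‖ₑ ^ 2 := by
  have h1 : ‖∫ x in I.toSet, (ρ x : ℂ) * h x‖ₑ ≤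
      ∫⁻ x in I.toSet, ((fun x => ‖ρ x‖ₑ) * fun x => ‖h x‖ₑ) x := by
    refine (enorm_integral_le_lintegral_enorm _).trans (le_of_eq ?_)
    refine lintegral_congr fun x => ?_
    simp only [Pi.mul_apply, enorm_mul]
    congr 1
    rw [← ofReal_norm, ← ofReal_norm, Complex.norm_real]
  have h2 := ENNReal.lintegral_mul_le_Lp_mul_Lq (volume.restrict I.toSet)
    Real.HolderConjugate.two_two hρ.restrict.enorm hh.restrict.enorm
  have h3 : ∀ x : ℝ≥0∞, (x ^ (1 / 2 : ℝ)) ^ 2 = x := fun x => by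
    rw [← ENNReal.rpow_natCast, ← ENNReal.rpow_mul]; norm_num
  calc ‖∫ x in I.toSet, (ρ x : ℂ) * h x‖ₑ ^ 2 ≤ _ := pow_le_pow_left' (h1.trans h2) 2
    _ = _ := by
      rw [mul_pow, h3, h3]
      congr 1
      · refine lintegral_congr_ae (ae_restrict_of_ae ?_)
        filter_upwards [hρv] with x hx
        rw [← hx, ENNReal.rpow_two, ← ofReal_norm, ← ENNReal.ofReal_pow (norm_nonneg _),
          Real.norm_eq_abs, sq_abs]
      · simp_rw [ENNReal.rpow_two]

theorem integrableOn_mul {ρ v : ℝ → ℝ} {h : ℝ → ℂ} (hv : IsWeight v)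
    (hρ : AEStronglyMeasurable ρ volume) (hρv : ∀ᵐ x ∂(volume : Measure ℝ), ρ x ^ 2 = v x)
    (hh : MemLp h 2 volume) (I : DyadicInterval) :
    IntegrableOn (fun x => (ρ x : ℂ) * h x) I.toSet := by
  have h1 : MemLp ρ 2 (volume.restrict I.toSet) := by
    rw [memLp_two_iff_integrable_sq hρ.restrict]
    exact (hv.integrableOn I).congr (ae_restrict_of_ae (hρv.mono fun x hx => hx.symm))
  exact MemLp.integrable_mul h1.ofReal (hh.restrict I.toSet)

/-- The weighted dyadic square function estimate. -/
theorem tsum_haarBlock_integral_le {A : ℝ} {ρ v : ℝ → ℝ} {γ : DyadicInterval → ℝ} {h : ℝ → ℂ}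
    (n : ℕ) (hv : IsWeight v) (hρ : AEStronglyMeasurable ρ volume)
    (hρv : ∀ᵐ x ∂(volume : Measure ℝ), ρ x ^ 2 = v x) (hh : MemLp h 2 volume)
    (hγ : ∀ I, 0 < γ I) (hγs : ∀ I, 2 * γ I ≤ γ I.rightHalf + γ I.leftHalf)
    (hγX : ∀ I, γ I ^ 2 ≤ (lavg v I).toReal) (hXγ : ∀ I, (lavg v I).toReal ≤ A * γ I ^ 2) :
    ∑' L : DyadicInterval, ENNReal.ofReal
        (‖haarBlock (fun I => ∫ x in I.toSet, (ρ x : ℂ) * h x) n L‖ ^ 2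
          / (L.len * (lavg v L).toReal))
      ≤ ENNReal.ofReal (386 * A) * eLpNorm h 2 volume ^ 2 := by
  set X : DyadicInterval → ℝ := fun I => (lavg v I).toReal with hXdef
  set G : DyadicInterval → ℂ := fun I => ∫ x in I.toSet, (ρ x : ℂ) * h x with hG
  have hX0 : ∀ I, 0 < X I := fun I =>
    ENNReal.toReal_pos (hv.lavg_ne_zero I) (hv.lavg_lt_top I).ne
  have hX : ∀ I, X I = (X I.rightHalf + X I.leftHalf) / 2 := fun I => by
    simp only [hXdef]
    rw [lavg_halves, ENNReal.toReal_div,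
      ENNReal.toReal_add (hv.lavg_lt_top _).ne (hv.lavg_lt_top _).ne]
    simp
  refine (tsum_haarBlock_le n hX0 hX).trans ?_
  have hGadd : ∀ I, G I = G I.rightHalf + G I.leftHalf :=
    integral_halves (integrableOn_mul hv hρ hρv hh)
  have hfin : ∀ I : DyadicInterval, ∫⁻ x in I.toSet, ‖h x‖ₑ ^ 2 ≠ ∞ := fun I =>
    ne_top_of_le_ne_top (by rw [lintegral_enorm_sq_eq]; exact ENNReal.pow_ne_top hh.2.ne)
      (setLIntegral_le_lintegral I.toSet _)
  have hl : ∀ I : DyadicInterval, I.len ≠ 0 := fun I => I.len_pos.ne'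
  have key := tsum_sq_increment_le (A := A) (X := X) (g := γ) (y := fun I => G I / I.len)
    (e := fun I => (∫⁻ x in I.toSet, ‖h x‖ₑ ^ 2).toReal / I.len) (M := eLpNorm h 2 volume ^ 2)
    hγ hX hγs hγX hXγ ?_ ?_ ?_
  · refine le_trans (le_of_eq (tsum_congr fun I => ?_)) key
    congr 1
    have hc : ((I.len : ℝ) : ℂ) ≠ 0 := by exact_mod_cast hl I
    have e : (G I.rightHalf / (I.rightHalf.len : ℂ) - G I.leftHalf / (I.leftHalf.len : ℂ)) / 2
        = (G I.rightHalf - G I.leftHalf) / (I.len : ℂ) := by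
      rw [len_leftHalf, len_rightHalf]
      push_cast
      field_simp
    have hx := (hX0 I).ne'
    have hl' := hl I
    rw [e, norm_div, Complex.norm_real, Real.norm_of_nonneg I.len_pos.le]
    field_simp
  · intro I
    have hc : ((I.len : ℝ) : ℂ) ≠ 0 := by exact_mod_cast hl I
    simp only [len_leftHalf, len_rightHalf]
    rw [hGadd I]
    push_cast
    field_simp
  · intro I
    have h1 := ENNReal.toReal_mono
      (ENNReal.mul_ne_top (by
        rw [← ofReal_len_mul_lavg]
        exact ENNReal.mul_ne_top ENNReal.ofReal_ne_top (hv.lavg_lt_top I).ne) (hfin I))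
      (enorm_integral_mul_sq_le hρ hρv hh.1 I)
    rw [← ofReal_len_mul_lavg, ENNReal.toReal_mul, ENNReal.toReal_mul, ENNReal.toReal_pow,
      toReal_enorm, ENNReal.toReal_ofReal I.len_pos.le] at h1
    have hp := I.len_pos
    rw [norm_div, Complex.norm_real, Real.norm_of_nonneg hp.le, div_pow,
      div_le_iff₀ (by positivity)]
    refine h1.trans (le_of_eq ?_)
    field_simp
    exact mul_comm _ _
  · intro j
    refine le_of_eq ?_
    rw [← lintegral_enorm_sq_eq, ← tsum_lintegral_scale _ j]
    refine tsum_congr fun k => ?_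
    rw [mul_div_cancel₀ _ (hl _), ENNReal.ofReal_toReal (hfin _)]

end SquareFunction

/-! ### Duality between Bessel bounds and synthesis bounds. -/

section Hilbert

variable {ι H : Type*} [NormedAddCommGroup H] [InnerProductSpace ℂ H]

/-- Test the sum y against itself: Cauchy-Schwarz and the Bessel bound at h = y give ‖y‖⁴ ≤ Q ‖y‖² ∑
‖aᵢ‖², and ‖y‖² cancels. -/
theorem norm_sum_smul_sq_le {φ : ι → H} {a : ι → ℂ} {Q : ℝ} (hQ : 0 ≤ Q) (S : Finset ι)
    (hφ : ∀ h : H, ∑ i ∈ S, ‖inner ℂ (φ i) h‖ ^ 2 ≤ Q * ‖h‖ ^ 2) :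
    ‖∑ i ∈ S, a i • φ i‖ ^ 2 ≤ Q * ∑ i ∈ S, ‖a i‖ ^ 2 := by
  set y := ∑ i ∈ S, a i • φ i with hy
  have h1 : ‖y‖ ^ 2 ≤ ∑ i ∈ S, ‖a i‖ * ‖inner ℂ (φ i) y‖ := by
    have : inner ℂ y y = ∑ i ∈ S, (starRingEnd ℂ) (a i) * inner ℂ (φ i) y := by
      conv_lhs => rw [hy, sum_inner]
      simp_rw [inner_smul_left, ← hy]
    have h2 : ‖y‖ ^ 2 = ‖inner ℂ y y‖ := by
      rw [inner_self_eq_norm_sq_to_K]; simp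
    rw [h2, this]
    refine (norm_sum_le _ _).trans (le_of_eq ?_)
    simp
  have h2 : (‖y‖ ^ 2) ^ 2 ≤ (∑ i ∈ S, ‖a i‖ ^ 2) * (Q * ‖y‖ ^ 2) := by
    calc (‖y‖ ^ 2) ^ 2 ≤ (∑ i ∈ S, ‖a i‖ * ‖inner ℂ (φ i) y‖) ^ 2 := by gcongr
      _ ≤ (∑ i ∈ S, ‖a i‖ ^ 2) * ∑ i ∈ S, ‖inner ℂ (φ i) y‖ ^ 2 :=
        Finset.sum_mul_sq_le_sq_mul_sq _ _ _
      _ ≤ _ := by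
        gcongr
        exact hφ y
  rcases (sq_nonneg ‖y‖).eq_or_lt with h0 | h0
  · rw [← h0]
    positivity
  · nlinarith

theorem exists_hasSum_smul [CompleteSpace H] {φ : ι → H} {a : ι → ℂ} {P Q : ℝ} (hQ : 0 ≤ Q)
    (hφ : ∀ (S : Finset ι) (h : H), ∑ i ∈ S, ‖inner ℂ (φ i) h‖ ^ 2 ≤ Q * ‖h‖ ^ 2)
    (ha : ∀ S : Finset ι, ∑ i ∈ S, ‖a i‖ ^ 2 ≤ P) :
    ∃ y, HasSum (fun i => a i • φ i) y ∧ ‖y‖ ^ 2 ≤ Q * P := by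
  have hb := fun S => norm_sum_smul_sq_le (a := a) hQ S (hφ S)
  have hsum : Summable fun i => ‖a i‖ ^ 2 := summable_of_sum_le (fun _ => sq_nonneg _) ha
  have hs : Summable fun i => a i • φ i := by
    rw [summable_iff_vanishing_norm]
    intro ε hε
    -- Dividing by Q + 1 instead of Q allows Q = 0.
    obtain ⟨s, hs⟩ := summable_iff_vanishing_norm.mp hsum (ε ^ 2 / (Q + 1)) (by positivity)
    refine ⟨s, fun t ht => ?_⟩
    have h1 := hs t ht
    rw [Real.norm_of_nonneg (Finset.sum_nonneg fun _ _ => sq_nonneg _),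
      lt_div_iff₀ (by positivity)] at h1
    refine lt_of_pow_lt_pow_left₀ 2 hε.le (lt_of_le_of_lt ((hb t).trans ?_) h1)
    rw [mul_comm]
    gcongr
    linarith
  refine ⟨_, hs.hasSum, ?_⟩
  refine le_of_tendsto ((hs.hasSum.norm).pow 2) (Eventually.of_forall fun S => ?_)
  exact (hb S).trans (by gcongr; exact ha S)

end Hilbert

/-! ### Factorization of the multiplier and the general bound. -/

section Operator

/-- The restriction of a real function to a dyadic interval, with complex values. -/
def dyadicPiece (ρ : ℝ → ℝ) (I : DyadicInterval) : ℝ → ℂ := I.toSet.indicator fun x => (ρ x : ℂ)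

theorem dyadicPiece_apply (ρ : ℝ → ℝ) (I : DyadicInterval) (x : ℝ) :
    dyadicPiece ρ I x = ρ x * ((I.toSet.indicator (fun _ => (1 : ℝ)) x : ℝ) : ℂ) := by
  unfold dyadicPiece
  by_cases hx : x ∈ I.toSet <;> simp [hx]

theorem memLp_dyadicPiece {ρ v : ℝ → ℝ} (hv : IsWeight v)
    (hρ : AEStronglyMeasurable ρ volume) (hρv : ∀ᵐ x ∂(volume : Measure ℝ), ρ x ^ 2 = v x)
    (I : DyadicInterval) : MemLp (dyadicPiece ρ I) 2 volume := by
  have h1 : MemLp ρ 2 (volume.restrict I.toSet) := by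
    rw [memLp_two_iff_integrable_sq hρ.restrict]
    exact (hv.integrableOn I).congr (ae_restrict_of_ae (hρv.mono fun x hx => hx.symm))
  exact (memLp_indicator_iff_restrict I.measurableSet_toSet).mpr h1.ofReal

theorem inner_dyadicPiece {ρ : ℝ → ℝ} {I : DyadicInterval}
    (hI : MemLp (dyadicPiece ρ I) 2 volume) (h : Lp ℂ 2 (volume : Measure ℝ)) :
    inner ℂ (hI.toLp) h = ∫ x in I.toSet, (ρ x : ℂ) * h x := by
  rw [L2.inner_def, ← integral_indicator I.measurableSet_toSet]
  refine integral_congr_ae ?_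
  filter_upwards [hI.coeFn_toLp] with x hx
  rw [hx, RCLike.inner_apply, dyadicPiece]
  by_cases hx : x ∈ I.toSet <;> simp [hx, mul_comm]

theorem haarCoeff_eq {f : ℝ → ℂ} (hf : ∀ I : DyadicInterval, IntegrableOn f I.toSet)
    (I : DyadicInterval) :
    haarCoeff f I = ((√I.len)⁻¹ : ℝ) *
      ((∫ x in I.rightHalf.toSet, f x) - ∫ x in I.leftHalf.toSet, f x) := by
  have e : ∀ x, f x * (haar I x : ℂ) = ((√I.len)⁻¹ : ℝ) *
      (I.rightHalf.toSet.indicator f x - I.leftHalf.toSet.indicator f x) := by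
    intro x
    rw [haar]
    push_cast
    by_cases h1 : x ∈ I.rightHalf.toSet <;> by_cases h2 : x ∈ I.leftHalf.toSet <;>
      simp [h1, h2, mul_comm]
  simp_rw [haarCoeff, e]
  rw [integral_const_mul, integral_sub, integral_indicator (measurableSet_toSet _),
    integral_indicator (measurableSet_toSet _)]
  · exact (integrable_indicator_iff (measurableSet_toSet _)).mpr (hf _)
  · exact (integrable_indicator_iff (measurableSet_toSet _)).mpr (hf _)

/-- The factor √(|I||J|) cancels the normalizations of both Haar functions, so the double sum over I
and J is a product of two sums; 1/|L| is shared equally between them. -/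
theorem haarMultiplierTerm_eq {f : ℝ → ℂ} (hf : ∀ I : DyadicInterval, IntegrableOn f I.toSet)
    (t : ℝ) (w : ℝ → ℝ) (m n : ℕ) (L : DyadicInterval) (x : ℝ) :
    haarMultiplierTerm t w m n f L x =
      (haarBlock (fun I => ∫ x in I.toSet, f x) m L / (√L.len : ℝ)) *
        (((((⨍ y in L.toSet, w y) ^ t * √L.len)⁻¹ : ℝ) : ℂ) *
          ∑ J ∈ L.descendants n, (dyadicPiece (fun x => w x ^ t) J.rightHalf x
            - dyadicPiece (fun x => w x ^ t) J.leftHalf x)) := by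
  have hL : ((√L.len : ℝ) : ℂ) * (√L.len : ℝ) = (L.len : ℝ) := by
    exact_mod_cast congrArg (fun z : ℝ => (z : ℂ)) (Real.mul_self_sqrt L.len_pos.le)
  have hL0 : ((√L.len : ℝ) : ℂ) ≠ 0 := by exact_mod_cast (Real.sqrt_pos.mpr L.len_pos).ne'
  set K : ℂ := (((⨍ y in L.toSet, w y) ^ t : ℝ) : ℂ) with hK
  have e : ∀ a b : ℂ, a / (√L.len : ℝ) * (((((⨍ y in L.toSet, w y) ^ t * √L.len)⁻¹ : ℝ) : ℂ) * b)
      = a * b * (K⁻¹ / (L.len : ℝ)) := by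
    intro a b
    rw [← hL]
    push_cast
    rw [← hK, mul_inv]
    field_simp
  rw [e, haarBlock, haarMultiplierTerm, Finset.sum_mul_sum, Finset.sum_mul]
  refine Finset.sum_congr rfl fun I _ => ?_
  rw [Finset.sum_mul]
  refine Finset.sum_congr rfl fun J _ => ?_
  rw [haarCoeff_eq hf, haar, Real.sqrt_mul I.len_pos.le, dyadicPiece_apply, dyadicPiece_apply]
  have hI0 : ((√I.len : ℝ) : ℂ) ≠ 0 := by exact_mod_cast (Real.sqrt_pos.mpr I.len_pos).ne'
  have hJ0 : ((√J.len : ℝ) : ℂ) ≠ 0 := by exact_mod_cast (Real.sqrt_pos.mpr J.len_pos).ne'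
  push_cast
  rw [← hK]
  field_simp

theorem average_eq_toReal_lavg {w : ℝ → ℝ} (hw : IsWeight w) (I : DyadicInterval) :
    ⨍ y in I.toSet, w y = (lavg w I).toReal := by
  rw [setAverage_eq, lavg_eq, integral_eq_lintegral_of_nonneg_ae
    (ae_restrict_of_ae (hw.ae_pos.mono fun x hx => hx.le)) hw.aestronglyMeasurable.restrict,
    ENNReal.toReal_div, ENNReal.toReal_ofReal I.len_pos.le, measureReal_def, volume_toSet,
    ENNReal.toReal_ofReal I.len_pos.le, smul_eq_mul, div_eq_inv_mul]

theorem isWeight_one : IsWeight fun _ => (1 : ℝ) :=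
  ⟨locallyIntegrable_const _, ae_of_all _ fun _ => one_pos⟩

/-- A bound in `[0, ∞]` for a sum of squares, in terms of real finite sums. -/
theorem sum_le_of_tsum_ofReal_le {ι : Type*} {F : ι → ℝ} {B : ℝ} (hF : ∀ i, 0 ≤ F i) (hB : 0 ≤ B)
    (h : ∑' i, ENNReal.ofReal (F i) ≤ ENNReal.ofReal B) (S : Finset ι) : ∑ i ∈ S, F i ≤ B := by
  rw [← ENNReal.ofReal_le_ofReal_iff hB, ENNReal.ofReal_sum_of_nonneg fun i _ => hF i]
  exact (ENNReal.sum_le_tsum S).trans h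

/-- The unweighted case: the weight, the submartingale and A are all equal to one. -/
theorem sum_haarBlock_sq_le {f : ℝ → ℂ} (hf : MemLp f 2 volume) (m : ℕ)
    (S : Finset DyadicInterval) :
    ∑ L ∈ S, ‖haarBlock (fun I => ∫ x in I.toSet, f x) m L / ((√L.len : ℝ) : ℂ)‖ ^ 2
      ≤ 386 * (eLpNorm f 2 volume).toReal ^ 2 := by
  have h := tsum_haarBlock_integral_le (A := 1) (ρ := fun _ => 1) (v := fun _ => 1)
    (γ := fun _ => 1) m isWeight_one aestronglyMeasurable_const (by simp) hf (by simp)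
    (by norm_num) (by simp [lavg_one]) (by simp [lavg_one])
  simp only [Complex.ofReal_one, one_mul, mul_one, lavg_one, ENNReal.toReal_one] at h
  refine sum_le_of_tsum_ofReal_le (fun _ => sq_nonneg _) (by positivity) ?_ S
  rw [ENNReal.ofReal_mul (by norm_num), ENNReal.ofReal_pow ENNReal.toReal_nonneg,
    ENNReal.ofReal_toReal hf.2.ne]
  refine le_trans (le_of_eq (tsum_congr fun L => ?_)) h
  rw [norm_div, Complex.norm_real, Real.norm_of_nonneg (Real.sqrt_nonneg _), div_pow,
    Real.sq_sqrt L.len_pos.le]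

/-- Boundedness of the `t`-Haar multiplier: the averages of `w ^ (2 * t)` are dominated by powers
of the averages of `w`, and are comparable to the squares of a submartingale. -/
theorem exists_isHaarMultiplier {t c A : ℝ} {w : ℝ → ℝ} {γ : DyadicInterval → ℝ}
    (hw : IsWeight w) (hv : IsWeight fun x => w x ^ (2 * t)) (hc : 0 ≤ c) (hA : 0 ≤ A)
    (hcw : ∀ I, (lavg (fun x => w x ^ (2 * t)) I).toReal ≤ c * (lavg w I).toReal ^ (2 * t))
    (hγ : ∀ I, 0 < γ I) (hγs : ∀ I, 2 * γ I ≤ γ I.rightHalf + γ I.leftHalf)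
    (hγX : ∀ I, γ I ^ 2 ≤ (lavg (fun x => w x ^ (2 * t)) I).toReal)
    (hXγ : ∀ I, (lavg (fun x => w x ^ (2 * t)) I).toReal ≤ A * γ I ^ 2)
    (m n : ℕ) {f : ℝ → ℂ} (hf : MemLp f 2 volume) :
    ∃ g : ℝ → ℂ, IsHaarMultiplier t w m n f g ∧
      eLpNorm g 2 volume ≤ ENNReal.ofReal (386 * √(c * A)) * eLpNorm f 2 volume := by
  have hρ := hw.aestronglyMeasurable_rpow t
  have hρv : ∀ᵐ x ∂(volume : Measure ℝ), (w x ^ t) ^ 2 = w x ^ (2 * t) := by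
    filter_upwards [hw.ae_pos] with x hx
    rw [mul_comm, Real.rpow_mul hx.le, Real.rpow_two]
  have hψ := memLp_dyadicPiece hv hρ hρv
  set ψ : DyadicInterval → Lp ℂ 2 (volume : Measure ℝ) := fun I => (hψ I).toLp _ with hψdef
  have hfI : ∀ I : DyadicInterval, IntegrableOn f I.toSet := fun I => by
    simpa using integrableOn_mul (ρ := fun _ => 1) isWeight_one aestronglyMeasurable_const
      (by simp) hf I
  set b : DyadicInterval → ℝ := fun L => ((⨍ y in L.toSet, w y) ^ t * √L.len)⁻¹ with hb
  set a : DyadicInterval → ℂ := fun L =>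
    haarBlock (fun I => ∫ x in I.toSet, f x) m L / ((√L.len : ℝ) : ℂ) with ha
  set φ : DyadicInterval → Lp ℂ 2 (volume : Measure ℝ) := fun L =>
    (b L : ℂ) • ∑ J ∈ L.descendants n, (ψ J.rightHalf - ψ J.leftHalf) with hφ
  have hinner : ∀ (S : Finset DyadicInterval) (h : Lp ℂ 2 (volume : Measure ℝ)),
      ∑ L ∈ S, ‖inner ℂ (φ L) h‖ ^ 2 ≤ 386 * (c * A) * ‖h‖ ^ 2 := by
    intro S h
    have h1 := tsum_haarBlock_integral_le n hv hρ hρv (Lp.memLp h) hγ hγs hγX hXγ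
    set G : DyadicInterval → ℂ := fun I => ∫ x in I.toSet, ((w x ^ t : ℝ) : ℂ) * h x with hG
    have h2 := sum_le_of_tsum_ofReal_le (B := 386 * A * ‖h‖ ^ 2) (fun L => by
      have := L.len_pos
      positivity) (by positivity) (h1.trans (le_of_eq (by
        rw [ENNReal.ofReal_mul (p := 386 * A) (by positivity),
          ENNReal.ofReal_pow (norm_nonneg _), Lp.norm_def,
          ENNReal.ofReal_toReal (Lp.memLp h).2.ne]))) S
    calc ∑ L ∈ S, ‖inner ℂ (φ L) h‖ ^ 2
        ≤ ∑ L ∈ S, c * (‖haarBlock G n L‖ ^ 2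
          / (L.len * (lavg (fun x => w x ^ (2 * t)) L).toReal)) := by
          refine Finset.sum_le_sum fun L _ => ?_
          have e : inner ℂ (φ L) h = (b L : ℂ) * haarBlock G n L := by
            simp only [hφ, inner_smul_left, sum_inner, inner_sub_left, hψdef, inner_dyadicPiece,
              haarBlock, hG, Complex.conj_ofReal]
          have hY : 0 < (lavg w L).toReal :=
            ENNReal.toReal_pos (hw.lavg_ne_zero L) (hw.lavg_lt_top L).ne
          have hX : 0 < (lavg (fun x => w x ^ (2 * t)) L).toReal :=
            ENNReal.toReal_pos (hv.lavg_ne_zero L) (hv.lavg_lt_top L).ne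
          have hl := L.len_pos
          have e2 : b L ^ 2 = ((lavg w L).toReal ^ (2 * t) * L.len)⁻¹ := by
            simp only [hb]
            rw [average_eq_toReal_lavg hw, inv_pow, mul_pow, Real.sq_sqrt hl.le,
              mul_comm 2 t, Real.rpow_mul hY.le, Real.rpow_two]
          have hYp : 0 < (lavg w L).toReal ^ (2 * t) := Real.rpow_pos_of_pos hY _
          -- The only use of c: it trades (m_L w)^{2t} in the multiplier for the average of w^{2t}
          -- in the square function.
          have e3 : b L ^ 2 ≤ c / (L.len * (lavg (fun x => w x ^ (2 * t)) L).toReal) := by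
            rw [e2, inv_eq_one_div, div_le_div_iff₀ (by positivity) (by positivity)]
            nlinarith [mul_le_mul_of_nonneg_left (hcw L) hl.le]
          rw [e, norm_mul, mul_pow, Complex.norm_real, Real.norm_eq_abs, sq_abs]
          calc b L ^ 2 * ‖haarBlock G n L‖ ^ 2
              ≤ c / (L.len * (lavg (fun x => w x ^ (2 * t)) L).toReal)
                * ‖haarBlock G n L‖ ^ 2 := by gcongr
            _ = _ := by ring
      _ ≤ c * (386 * A * ‖h‖ ^ 2) := by
          rw [← Finset.mul_sum]
          gcongr
      _ = _ := by ring
  obtain ⟨y, hy, hyn⟩ := exists_hasSum_smul (by positivity) hinner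
    (sum_haarBlock_sq_le hf m)
  refine ⟨y, ⟨Lp.memLp y, ?_⟩, ?_⟩
  · have h1 := (Lp.tendsto_Lp_iff_tendsto_eLpNorm' _ _).mp hy
    refine h1.congr fun S => eLpNorm_congr_ae ?_
    have hall : ∀ᵐ x, ∀ I, ψ I x = dyadicPiece (fun x => w x ^ t) I x := by
      have : Countable DyadicInterval := equivProd.countable_iff.mpr inferInstance
      exact ae_all_iff.mpr fun I => (hψ I).coeFn_toLp
    have hL : ∀ L, (a L • φ L : Lp ℂ 2 (volume : Measure ℝ)) =ᵐ[volume]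
        haarMultiplierTerm t w m n f L := by
      intro L
      have hsub : ∀ᵐ x, ∀ J ∈ L.descendants n,
          (ψ J.rightHalf - ψ J.leftHalf : Lp ℂ 2 (volume : Measure ℝ)) x
            = ψ J.rightHalf x - ψ J.leftHalf x :=
        (Finset.eventually_all _).mpr fun J _ => Lp.coeFn_sub _ _
      filter_upwards [Lp.coeFn_smul (a L) (φ L), Lp.coeFn_smul (b L : ℂ)
        (∑ J ∈ L.descendants n, (ψ J.rightHalf - ψ J.leftHalf)),
        Lp.coeFn_finsetSum (L.descendants n)
          (fun J => ψ J.rightHalf - ψ J.leftHalf), hall, hsub] with x h1 h2 h3 h4 h5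
      rw [h1, Pi.smul_apply, h2, Pi.smul_apply, h3, haarMultiplierTerm_eq hfI, smul_eq_mul,
        smul_eq_mul, Finset.sum_apply]
      congr 2
      refine Finset.sum_congr rfl fun J hJ => ?_
      rw [h5 J hJ, h4, h4]
    have hLS : ∀ᵐ x, ∀ L ∈ S, (a L • φ L : Lp ℂ 2 (volume : Measure ℝ)) x
        = haarMultiplierTerm t w m n f L x :=
      (Finset.eventually_all _).mpr fun L _ => hL L
    filter_upwards [Lp.coeFn_finsetSum S (fun L => a L • φ L), hLS] with x h1 h2
    rw [Pi.sub_apply, h1, Finset.sum_apply, Finset.sum_congr rfl h2]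
  · have h1 : ‖y‖ ≤ 386 * √(c * A) * (eLpNorm f 2 volume).toReal := by
      refine le_of_pow_le_pow_left₀ two_ne_zero (by positivity) ?_
      refine hyn.trans (le_of_eq ?_)
      rw [mul_pow, mul_pow, Real.sq_sqrt (by positivity)]
      ring
    have h2 := ENNReal.ofReal_le_ofReal h1
    rwa [ENNReal.ofReal_mul (by positivity), ENNReal.ofReal_toReal hf.2.ne, Lp.norm_def,
      ENNReal.ofReal_toReal (Lp.memLp y).2.ne] at h2

end Operator

/-! ### The two choices of submartingale, and uniqueness of the sum. -/

section Bounds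

/-- Midpoint convexity of a negative power, by the arithmetic-geometric mean inequality applied once
to a, b and once to their powers. -/
theorem two_mul_rpow_neg_le {a b r : ℝ} (ha : 0 < a) (hb : 0 < b) (hr : 0 ≤ r) :
    2 * ((a + b) / 2) ^ (-r) ≤ a ^ (-r) + b ^ (-r) := by
  have h1 : √(a * b) ≤ (a + b) / 2 := by
    rw [Real.sqrt_le_left (by positivity)]
    nlinarith [sq_nonneg (a - b)]
  have h2 : ((a + b) / 2) ^ (-r) ≤ √(a * b) ^ (-r) :=
    Real.rpow_le_rpow_of_nonpos (by positivity) h1 (by linarith)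
  have h3 : √(a * b) ^ (-r) = √(a ^ (-r)) * √(b ^ (-r)) := by
    rw [Real.sqrt_eq_rpow, Real.sqrt_eq_rpow, Real.sqrt_eq_rpow, ← Real.rpow_mul (by positivity),
      ← Real.rpow_mul ha.le, ← Real.rpow_mul hb.le, mul_comm (1 / 2 : ℝ),
      Real.mul_rpow ha.le hb.le]
  have h4 := two_mul_le_add_sq √(a ^ (-r)) √(b ^ (-r))
  rw [Real.sq_sqrt (by positivity), Real.sq_sqrt (by positivity)] at h4
  linarith

theorem two_mul_rpow_le {a b r : ℝ} (ha : 0 ≤ a) (hb : 0 ≤ b) (hr : 1 ≤ r) :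
    2 * ((a + b) / 2) ^ r ≤ a ^ r + b ^ r := by
  have h := (convexOn_rpow hr).2 (Set.mem_Ici.mpr ha) (Set.mem_Ici.mpr hb)
    (show (0 : ℝ) ≤ 1 / 2 by norm_num) (show (0 : ℝ) ≤ 1 / 2 by norm_num) (by norm_num)
  simp only [smul_eq_mul] at h
  rw [show 1 / 2 * a + 1 / 2 * b = (a + b) / 2 by ring] at h
  linarith

theorem ofReal_sqrt_toReal_mul {c A : ℝ≥0∞} (hc : c ≠ ∞) (hA : A ≠ ∞) :
    ENNReal.ofReal √(c.toReal * A.toReal) = c ^ (1 / 2 : ℝ) * A ^ (1 / 2 : ℝ) := by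
  rw [← ENNReal.mul_rpow_of_nonneg _ _ (by norm_num), ← ENNReal.toReal_mul, Real.sqrt_eq_rpow,
    ENNReal.toReal_rpow, ENNReal.ofReal_toReal]
  exact ENNReal.rpow_ne_top_of_nonneg (by norm_num) (ENNReal.mul_ne_top hc hA)

theorem toReal_lavg_halves {w : ℝ → ℝ} (hw : IsWeight w) (I : DyadicInterval) :
    (lavg w I).toReal = ((lavg w I.rightHalf).toReal + (lavg w I.leftHalf).toReal) / 2 := by
  rw [lavg_halves, ENNReal.toReal_div,
    ENNReal.toReal_add (hw.lavg_lt_top _).ne (hw.lavg_lt_top _).ne]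
  simp

theorem MemC.toReal_lavg_rpow_le {s : ℝ} {w : ℝ → ℝ} (h : MemC s w) (I : DyadicInterval) :
    (lavg (fun x => w x ^ s) I).toReal ≤ (cChar s w).toReal * (lavg w I).toReal ^ s := by
  rw [ENNReal.toReal_rpow, ← ENNReal.toReal_mul]
  refine ENNReal.toReal_mono (ENNReal.mul_ne_top h.char_lt_top.ne ?_)
    (lavg_rpow_le_cChar_mul h.isWeight I)
  exact fun hT => (ENNReal.rpow_eq_top_iff.mp hT).elim
    (fun h0 => h.isWeight.lavg_ne_zero I h0.1) fun h1 => (h.isWeight.lavg_lt_top I).ne h1.1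

/-- With Z the average of the dual weight of v = w^{2t}, the submartingale is Z^{-(q-1)/2}. Its
square is a lower bound for m_I v by Hölder, and an upper bound up to the factor [v]_{A_q} by
definition. -/
theorem exists_isHaarMultiplier_of_memAp {t q : ℝ} {w : ℝ → ℝ} (hw : MemC (2 * t) w)
    (hv : MemAp q fun x => w x ^ (2 * t)) (m n : ℕ) {f : ℝ → ℂ} (hf : MemLp f 2 volume) :
    ∃ g : ℝ → ℂ, IsHaarMultiplier t w m n f g ∧
      eLpNorm g 2 volume ≤ 386 * (cChar (2 * t) w ^ (1 / 2 : ℝ)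
        * apChar q (fun x => w x ^ (2 * t)) ^ (1 / 2 : ℝ)) * eLpNorm f 2 volume := by
  set v : ℝ → ℝ := fun x => w x ^ (2 * t) with hvdef
  have hq1 : 0 < q - 1 := by have := hv.one_lt; linarith
  have hσ := hv.isWeight_dual
  set Z : DyadicInterval → ℝ := fun I => (lavg (fun x => v x ^ (-1 / (q - 1))) I).toReal with hZ
  have hZ0 : ∀ I, 0 < Z I := fun I =>
    ENNReal.toReal_pos (hσ.lavg_ne_zero I) (hσ.lavg_lt_top I).ne
  have hsq : ∀ I, (Z I ^ (-((q - 1) / 2))) ^ 2 = (Z I ^ (q - 1))⁻¹ := fun I => by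
    rw [← Real.rpow_two, ← Real.rpow_mul (hZ0 I).le, ← Real.rpow_neg (hZ0 I).le]
    congr 1
    ring
  have hprod : ∀ I, (lavg v I * lavg (fun x => v x ^ (-1 / (q - 1))) I ^ (q - 1)).toReal
      = (lavg v I).toReal * Z I ^ (q - 1) := fun I => by
    rw [ENNReal.toReal_mul, ENNReal.toReal_rpow]
  obtain ⟨g, hg, hgn⟩ := exists_isHaarMultiplier (c := (cChar (2 * t) w).toReal)
    (A := (apChar q v).toReal) (γ := fun I => Z I ^ (-((q - 1) / 2))) hw.isWeight hv.isWeight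
    ENNReal.toReal_nonneg ENNReal.toReal_nonneg hw.toReal_lavg_rpow_le
    (fun I => Real.rpow_pos_of_pos (hZ0 I) _)
    (fun I => by
      simp only [hZ]
      rw [toReal_lavg_halves hσ I]
      exact two_mul_rpow_neg_le (hZ0 _) (hZ0 _) (by positivity))
    (fun I => by
      have hp := Real.rpow_pos_of_pos (hZ0 I) (q - 1)
      rw [hsq, inv_le_iff_one_le_mul₀ hp, ← hprod]
      have := ENNReal.toReal_mono (ne_top_of_le_ne_top hv.char_lt_top.ne
        (lavg_mul_le_apChar q v I)) (hv.isWeight.one_le_lavg_mul hv.one_lt I)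
      simpa using this)
    (fun I => by
      have hp := Real.rpow_pos_of_pos (hZ0 I) (q - 1)
      rw [hsq, ← div_eq_mul_inv, le_div_iff₀ hp, ← hprod]
      exact ENNReal.toReal_mono hv.char_lt_top.ne (lavg_mul_le_apChar q v I)) m n hf
  refine ⟨g, hg, hgn.trans (le_of_eq ?_)⟩
  rw [ENNReal.ofReal_mul (by norm_num), ofReal_sqrt_toReal_mul hw.char_lt_top.ne hv.char_lt_top.ne]
  norm_num

/-- For t ≥ 1 the powers (m_I w)^t already form a submartingale, and their squares are comparable to
m_I w^{2t} by Jensen and the C_{2t} condition. No Muckenhoupt condition enters. -/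
theorem exists_isHaarMultiplier_of_one_le {t : ℝ} {w : ℝ → ℝ} (ht : 1 ≤ t)
    (hw : MemC (2 * t) w) (m n : ℕ) {f : ℝ → ℂ} (hf : MemLp f 2 volume) :
    ∃ g : ℝ → ℂ, IsHaarMultiplier t w m n f g ∧
      eLpNorm g 2 volume ≤ 386 * cChar (2 * t) w * eLpNorm f 2 volume := by
  have hv := hw.isWeight_rpow
  have hY0 : ∀ I, 0 < (lavg w I).toReal := fun I =>
    ENNReal.toReal_pos (hw.isWeight.lavg_ne_zero I) (hw.isWeight.lavg_lt_top I).ne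
  have hsq : ∀ I, ((lavg w I).toReal ^ t) ^ 2 = (lavg w I).toReal ^ (2 * t) := fun I => by
    rw [← Real.rpow_two, ← Real.rpow_mul (hY0 I).le, mul_comm]
  obtain ⟨g, hg, hgn⟩ := exists_isHaarMultiplier (c := (cChar (2 * t) w).toReal)
    (A := (cChar (2 * t) w).toReal) (γ := fun I => (lavg w I).toReal ^ t) hw.isWeight hv
    ENNReal.toReal_nonneg ENNReal.toReal_nonneg hw.toReal_lavg_rpow_le
    (fun I => Real.rpow_pos_of_pos (hY0 I) _)
    (fun I => by
      rw [toReal_lavg_halves hw.isWeight I]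
      exact two_mul_rpow_le (hY0 _).le (hY0 _).le ht)
    (fun I => by
      rw [hsq, ENNReal.toReal_rpow]
      exact ENNReal.toReal_mono (hv.lavg_lt_top I).ne
        (hw.isWeight.rpow_lavg_le (by linarith) I))
    (fun I => by
      rw [hsq]
      exact hw.toReal_lavg_rpow_le I) m n hf
  refine ⟨g, hg, hgn.trans (le_of_eq ?_)⟩
  rw [Real.sqrt_mul_self ENNReal.toReal_nonneg, ENNReal.ofReal_mul (by norm_num),
    ENNReal.ofReal_toReal hw.char_lt_top.ne]
  norm_num

theorem aestronglyMeasurable_haarMultiplierTerm {w : ℝ → ℝ} (hw : IsWeight w) (t : ℝ)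
    (m n : ℕ) (f : ℝ → ℂ) (L : DyadicInterval) :
    AEStronglyMeasurable (haarMultiplierTerm t w m n f L) volume := by
  have h1 : AEMeasurable (fun x => w x ^ t) volume :=
    (hw.aestronglyMeasurable_rpow t).aemeasurable
  have h2 : ∀ J : DyadicInterval, Measurable (haar J) := fun J =>
    ((measurable_const.indicator (measurableSet_toSet _)).sub
      (measurable_const.indicator (measurableSet_toSet _))).const_mul _
  unfold haarMultiplierTerm
  refine Finset.aestronglyMeasurable_fun_sum _ fun I _ =>
    Finset.aestronglyMeasurable_fun_sum _ fun J _ => AEMeasurable.aestronglyMeasurable ?_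
  have h3 := h2 J
  exact (((h1.div_const _).complex_ofReal.const_mul _).mul_const _).mul
    h3.aemeasurable.complex_ofReal

/-- Needed because the two choices of submartingale each produce a sum of the series, while the
final bounds concern a single function. -/
theorem IsHaarMultiplier.ae_eq {t : ℝ} {w : ℝ → ℝ} {m n : ℕ} {f g g' : ℝ → ℂ} (hw : IsWeight w)
    (h : IsHaarMultiplier t w m n f g) (h' : IsHaarMultiplier t w m n f g') : g =ᵐ[volume] g' := by
  have hm : ∀ S : Finset DyadicInterval,
      AEStronglyMeasurable (fun x => ∑ L ∈ S, haarMultiplierTerm t w m n f L x) volume := fun S =>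
    Finset.aestronglyMeasurable_fun_sum _ fun L _ =>
      aestronglyMeasurable_haarMultiplierTerm hw t m n f L
  have hlim := h'.tendsto.add h.tendsto
  rw [add_zero] at hlim
  have h0 : eLpNorm (g - g') 2 volume ≤ 0 := by
    refine ge_of_tendsto' hlim fun S => ?_
    have e : g - g' = (fun x => (∑ L ∈ S, haarMultiplierTerm t w m n f L x) - g' x)
        - fun x => (∑ L ∈ S, haarMultiplierTerm t w m n f L x) - g x := by
      ext x
      simp
    rw [e]
    exact eLpNorm_sub_le ((hm S).sub h'.memLp.1) ((hm S).sub h.memLp.1) (by norm_num)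
  have h1 := (eLpNorm_eq_zero_iff (h.memLp.1.sub h'.memLp.1) two_ne_zero).mp (le_zero_iff.mp h0)
  filter_upwards [h1] with x hx
  exact sub_eq_zero.mp hx

theorem le_complexity_mul (m n : ℕ) (B N : ℝ≥0∞) :
    386 * B * N ≤ ((386 : ℝ≥0) : ℝ≥0∞) * (m + n + 2) ^ 3 * B * N := by
  have h : (1 : ℝ≥0∞) ≤ (m + n + 2) ^ 3 :=
    one_le_pow₀ (le_trans (by norm_num) (le_add_self (a := (2 : ℝ≥0∞))))
  have e : ((386 : ℝ≥0) : ℝ≥0∞) = 386 := rfl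
  rw [e]
  gcongr
  exact le_mul_of_one_le_right' h

end Bounds

/-! ### Membership of w^{2t} in Muckenhoupt classes. -/

section Classes

variable {t : ℝ} {w : ℝ → ℝ}

theorem MemC.memAp_rpow_of_lt_one {q : ℝ} (hw : MemC (2 * t) w) (h0 : 0 ≤ 2 * t)
    (h1 : 2 * t < 1) (hq : MemAp q w) : MemAp q fun x => w x ^ (2 * t) :=
  ⟨hq.one_lt, hw.isWeight_rpow, (apChar_rpow_le hw.isWeight h0 h1.le hq).trans_lt
    (ENNReal.rpow_lt_top_of_nonneg h0 hq.char_lt_top.ne)⟩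

theorem MemC.memAp_rpow_of_one_le {p : ℝ} (hw : MemC (2 * t) w) (h1 : 1 ≤ 2 * t)
    (hp : MemAp p w) : MemAp (2 * t * (p - 1) + 1) fun x => w x ^ (2 * t) := by
  have hp1 := hp.one_lt
  refine ⟨by nlinarith, hw.isWeight_rpow,
    (apChar_rpow_le_cChar_mul hw.isWeight (by linarith) hp1).trans_lt
      (ENNReal.mul_lt_top hw.char_lt_top ?_)⟩
  exact ENNReal.rpow_lt_top_of_nonneg (by linarith) hp.char_lt_top.ne

theorem MemC.memAp_rpow_of_neg (hw : MemC (2 * t) w) (ht : t < 0) :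
    MemAp (1 - 2 * t) fun x => w x ^ (2 * t) := by
  refine ⟨by linarith, hw.isWeight_rpow, ?_⟩
  rw [apChar_rpow_eq_cChar hw.isWeight (by linarith)]
  exact hw.char_lt_top

theorem MemC.memAp_of_neg (hw : MemC (2 * t) w) (ht : t < 0) : MemAp (1 - 1 / (2 * t)) w := by
  have hs : 2 * t < 0 := by linarith
  refine ⟨by have := one_div_neg.mpr hs; linarith, hw.isWeight, ?_⟩
  have h := hw.char_lt_top
  rw [cChar_eq_apChar_rpow hs] at h
  exact (ENNReal.rpow_lt_top_iff_of_pos (by linarith)).mp h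

theorem rpow_half_le_of_le_rpow {a b : ℝ≥0∞} (h : a ≤ b ^ (2 * t)) :
    a ^ (1 / 2 : ℝ) ≤ b ^ t := by
  refine (ENNReal.rpow_le_rpow h (by norm_num)).trans (le_of_eq ?_)
  rw [← ENNReal.rpow_mul]
  congr 1
  ring

theorem cChar_mul_apChar_rpow_half_le {p : ℝ} (hw : IsWeight w) (h1 : 1 ≤ 2 * t) (hp : 1 < p) :
    cChar (2 * t) w ^ (1 / 2 : ℝ)
        * apChar (2 * t * (p - 1) + 1) (fun x => w x ^ (2 * t)) ^ (1 / 2 : ℝ)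
      ≤ cChar (2 * t) w * apChar p w ^ t := by
  have h := ENNReal.rpow_le_rpow
    (apChar_rpow_le_cChar_mul hw (show 0 < 2 * t by linarith) hp) (show (0 : ℝ) ≤ 1 / 2 by norm_num)
  rw [ENNReal.mul_rpow_of_nonneg _ _ (by norm_num), ← ENNReal.rpow_mul,
    show 2 * t * (1 / 2) = t by ring] at h
  calc _ ≤ cChar (2 * t) w ^ (1 / 2 : ℝ) * (cChar (2 * t) w ^ (1 / 2 : ℝ) * apChar p w ^ t) := by
        gcongr
    _ = _ := by
        rw [← mul_assoc, ← ENNReal.rpow_add_of_nonneg _ _ (by norm_num) (by norm_num)]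
        norm_num

end Classes

end

/-! ### The theorem. -/

theorem theorem2 :
    ∃ (C C' : ℝ → ℝ≥0) (C₀ : ℝ≥0), ∀ (t : ℝ) (w : ℝ → ℝ), MemC (2 * t) w →
      -- membership of `w^{2t}` in some `A_q^d`
      (MemAInfty w → ∃ q : ℝ, MemAp q (fun x => w x ^ (2 * t))) ∧
      -- (i)
      (0 ≤ 2 * t → 2 * t < 1 → ∀ q : ℝ, MemAp q w →
        MemAp q (fun x => w x ^ (2 * t)) ∧
        apChar q (fun x => w x ^ (2 * t)) ^ (1 / 2 : ℝ) ≤ apChar q w ^ t ∧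
        ∀ (m n : ℕ) (f : ℝ → ℂ), MemLp f 2 volume →
          ∃ g : ℝ → ℂ, IsHaarMultiplier t w m n f g ∧
            eLpNorm g 2 volume ≤
              C q * (m + n + 2) ^ 3 * apChar q (fun x => w x ^ (2 * t)) ^ (1 / 2 : ℝ)
                * eLpNorm f 2 volume ∧
            eLpNorm g 2 volume ≤
              C q * (m + n + 2) ^ 3 * apChar q w ^ t * eLpNorm f 2 volume) ∧
      -- (ii)
      (1 ≤ 2 * t → ∀ p q : ℝ, MemAp p w → q = 2 * t * (p - 1) + 1 →
        MemAp q (fun x => w x ^ (2 * t)) ∧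
        C q * (cChar (2 * t) w ^ (1 / 2 : ℝ)
            * apChar q (fun x => w x ^ (2 * t)) ^ (1 / 2 : ℝ)) ≤
          C' p * (cChar (2 * t) w * apChar p w ^ t) ∧
        ∀ (m n : ℕ) (f : ℝ → ℂ), MemLp f 2 volume →
          ∃ g : ℝ → ℂ, IsHaarMultiplier t w m n f g ∧
            eLpNorm g 2 volume ≤
              C q * (m + n + 2) ^ 3 * (cChar (2 * t) w ^ (1 / 2 : ℝ)
                * apChar q (fun x => w x ^ (2 * t)) ^ (1 / 2 : ℝ)) * eLpNorm f 2 volume ∧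
            eLpNorm g 2 volume ≤
              C' p * (m + n + 2) ^ 3 * (cChar (2 * t) w * apChar p w ^ t)
                * eLpNorm f 2 volume ∧
            eLpNorm g 2 volume ≤
              C' p * (m + n + 2) ^ 3 * (cChar (2 * t) w * apChar p w)
                * eLpNorm f 2 volume) ∧
      -- (iii)
      (t < 0 →
        MemAp (1 - 2 * t) (fun x => w x ^ (2 * t)) ∧
        MemAp (1 - 1 / (2 * t)) w ∧
        cChar (2 * t) w = apChar (1 - 1 / (2 * t)) w ^ (-2 * t) ∧
        ∀ (m n : ℕ) (f : ℝ → ℂ), MemLp f 2 volume →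
          ∃ g : ℝ → ℂ, IsHaarMultiplier t w m n f g ∧
            eLpNorm g 2 volume ≤
              C₀ * (m + n + 2) ^ 3 * cChar (2 * t) w * eLpNorm f 2 volume) := by
  -- All constants are the absolute constant of the square function estimate.
  refine ⟨fun _ => 386, fun _ => 386, 386, fun t w hw => ⟨?_, ?_, ?_, ?_⟩⟩
  · rintro ⟨p, hp⟩
    rcases lt_or_ge t 0 with ht | ht
    · exact ⟨_, hw.memAp_rpow_of_neg ht⟩
    · rcases lt_or_ge (2 * t) 1 with h1 | h1
      · exact ⟨_, hw.memAp_rpow_of_lt_one (by linarith) h1 hp⟩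
      · exact ⟨_, hw.memAp_rpow_of_one_le h1 hp⟩
  · intro h0 h1 q hq
    have hv := hw.memAp_rpow_of_lt_one h0 h1 hq
    have hle := rpow_half_le_of_le_rpow (apChar_rpow_le hw.isWeight h0 h1.le hq)
    refine ⟨hv, hle, fun m n f hf => ?_⟩
    obtain ⟨g, hg, hgn⟩ := exists_isHaarMultiplier_of_memAp hw hv m n hf
    have hb : eLpNorm g 2 volume ≤ 386 * apChar q (fun x => w x ^ (2 * t)) ^ (1 / 2 : ℝ)
        * eLpNorm f 2 volume := by
      refine hgn.trans ?_
      gcongr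
      refine mul_le_of_le_one_left' ?_
      exact ENNReal.rpow_le_one (cChar_le_one hw.isWeight h0 h1.le) (by norm_num)
    refine ⟨g, hg, hb.trans (le_complexity_mul m n _ _), ?_⟩
    exact (hb.trans (by gcongr)).trans (le_complexity_mul m n _ _)
  · rintro h1 p q hp rfl
    have hv := hw.memAp_rpow_of_one_le h1 hp
    have hle := cChar_mul_apChar_rpow_half_le hw.isWeight h1 hp.one_lt
    refine ⟨hv, by gcongr, fun m n f hf => ?_⟩
    obtain ⟨g, hg, hgn⟩ := exists_isHaarMultiplier_of_memAp hw hv m n hf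
    have hb : eLpNorm g 2 volume ≤ 386 * (cChar (2 * t) w * apChar p w ^ t)
        * eLpNorm f 2 volume := hgn.trans (by gcongr)
    refine ⟨g, hg, hgn.trans (le_complexity_mul m n _ _), hb.trans (le_complexity_mul m n _ _), ?_⟩
    have hA := one_le_apChar hp.isWeight hp.one_lt
    refine le_trans ?_ (le_complexity_mul m n _ _)
    -- For t ≤ 1 the power t of [w]_{A_p} ≥ 1 is at most its first power. For t ≥ 1 the second
    -- submartingale gives a bound by [w]_{C_{2t}} alone.
    rcases le_total t 1 with ht | ht
    · refine hb.trans ?_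
      gcongr
      exact (ENNReal.rpow_le_rpow_of_exponent_le hA ht).trans (ENNReal.rpow_one _).le
    · obtain ⟨g', hg', hgn'⟩ := exists_isHaarMultiplier_of_one_le ht hw m n hf
      rw [eLpNorm_congr_ae (hg.ae_eq hw.isWeight hg')]
      refine hgn'.trans ?_
      gcongr
      exact le_mul_of_one_le_right' hA
  · intro ht
    have hs : 2 * t < 0 := by linarith
    have hv := hw.memAp_rpow_of_neg ht
    refine ⟨hv, hw.memAp_of_neg ht, ?_, fun m n f hf => ?_⟩
    · rw [cChar_eq_apChar_rpow hs, neg_mul]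
    · obtain ⟨g, hg, hgn⟩ := exists_isHaarMultiplier_of_memAp hw hv m n hf
      refine ⟨g, hg, le_trans (hgn.trans (le_of_eq ?_)) (le_complexity_mul m n _ _)⟩
      -- The two characteristics coincide, so the two square roots multiply to [w]_{C_{2t}}.
      rw [apChar_rpow_eq_cChar hw.isWeight hs,
        ← ENNReal.rpow_add_of_nonneg _ _ (by norm_num) (by norm_num)]
      norm_num
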